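/- Let $L,T,D,k_2>0$, write $H^2_*=\{v\in H^2(0,L): v(0)=v_x(0)=0\}$ and $$\mathcal D(\mathcal A)=\{v\in H^4(0,L): v(0)=v_x(0)=0,\ v_{xx}(L)=v_{xxx}(L)=0\},$$ and let $p\in L^2(0,T;L^2(0,L))$, $w_0\in H^2_*$, $w_1\in L^2(0,L)$. Consider the damped inextensible cantilever $$w_{tt}+D\partial_x^4w+k_2\partial_x^4w_t-D\partial_x[w_{xx}^2w_x]+D\partial_{xx}[w_{xx}w_x^2]+\partial_x\Big[w_x\int_x^Lu_{tt}\,d\xi\Big]=p,\qquad u_{tt}(x)=-\int_0^x[w_{xt}^2+w_xw_{xtt}]\,d\xi,\tag{1}$$ on $(0,L)\times(0,T)$, with $w(0,t)=w_x(0,t)=0$, $w_{xx}(L,t)=w_{xxx}(L,t)=0$, $w(\cdot,0)=w_0$, $w_t(\cdot,0)=w_1$. Call $w$ a *weak-form solution* if, for every $\phi\in H^2_*$ and a.e. $t\in(0,T)$, $$(w_{tt},\phi)+D(w_{xx},\phi_{xx})+k_2(w_{xxt},\phi_{xx})+D(w_{xx}w_x,w_x\phi_{xx})+D(w_{xx}w_x,w_{xx}\phi_x)-\Big(w_x\int_x^Lu_{tt}\,d\xi,\phi_x\Big)=(p,\phi)$$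 in $L^2(0,L)$ inner products, and $D(w_{xx},\chi_{xx})\to D(w_{0,xx},\chi_{xx})$ for every $\chi\in H^2_*$ and $(w_t,\psi)\to(w_1,\psi)$ for every $\psi\in L^2(0,L)$, as $t\to0^+$. A *strong solution* is a weak-form solution with $$w\in L^2(0,T;\mathcal D(\mathcal A)),\quad w_t\in L^2(0,T;\mathcal D(\mathcal A)),\quad w_{tt}\in L^2(0,T;H^2_*),$$ time derivatives being weak ones. (a) Every strong solution satisfies (1) in $L^2(0,T;L^2(0,L))$: the weak derivatives $\partial_x[w_{xx}^2w_x]$, $\partial_{xx}[w_{xx}w_x^2]$ and $\partial_x[w_x\int_x^Lu_{tt}]$ exist in $L^2(0,T;L^2(0,L))$ and the two sides of (1) agree. Moreover $w$ has a representative in $C([0,T];H^4(0,L))$ with $w(\cdot,0)=w_0$ and $$w(0,t)=w_x(0,t)=0,\qquad w_{xx}(L,t)=w_{xxx}(L,t)=0\qquad\text{for all }0\le t\le T,$$ and $w_t$ has a representative in $C([0,T];L^2(0,L))$ with $w_t(\cdot,0)=w_1$. (b) The free-end conditions need not be presupposed for $t>0$: if $w_0\in\mathcal D(\mathcal A)$,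 and $w$ is a weak-form solution with only $w,w_t\in L^2(0,T;H^4(0,L)\cap H^2_*)$ and $w_{tt}\in L^2(0,T;H^2_*)$, then all the conclusions of (a) hold. -/

import Mathlib

open MeasureTheory Set Filter Topology
open scoped ContDiff

noncomputable section

namespace Cantilever

/-- The Lebesgue space `L²(0,L)`. -/
abbrev L2 (L : ℝ) : Type := Lp ℝ 2 (volume.restrict (Ioo 0 L))

/-- `φ` is a test function on the interval `(0,a)`. -/
def IsTest (a : ℝ) (φ : ℝ → ℝ) : Prop :=
  ContDiff ℝ ∞ φ ∧ HasCompactSupport φ ∧ tsupport φ ⊆ Ioo 0 a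

/-- For integrable functions `f`, `g` on `(0,L)`: `g` is the `k`-th weak derivative of `f`. -/
def IsWeakDeriv (L : ℝ) (k : ℕ) (f g : ℝ → ℝ) : Prop :=
  IntegrableOn f (Ioo 0 L) ∧ IntegrableOn g (Ioo 0 L) ∧
    ∀ φ : ℝ → ℝ, IsTest L φ →
      ∫ x in Ioo 0 L, f x * iteratedDeriv k φ x = (-1) ^ k * ∫ x in Ioo 0 L, g x * φ x

theorem IsTest.integrable_mul {L : ℝ} {φ : ℝ → ℝ} (hφ : IsTest L φ) (k : ℕ) {f : ℝ → ℝ}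
    (hf : IntegrableOn f (Ioo 0 L)) :
    IntegrableOn (fun x => f x * iteratedDeriv k φ x) (Ioo 0 L) := by
  have hc : Continuous (iteratedDeriv k φ) :=
    hφ.1.continuous_iteratedDeriv k (by exact_mod_cast le_top)
  have hs : HasCompactSupport (iteratedDeriv k φ) := by
    have h := hφ.2.1.iteratedFDeriv (𝕜 := ℝ) k
    refine h.mono' ?_
    intro x hx
    apply subset_tsupport
    intro h0
    apply hx
    rw [iteratedDeriv_eq_iteratedFDeriv, h0]
    rfl
  obtain ⟨C, hC⟩ := hs.exists_bound_of_continuous hc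
  exact Integrable.mul_bdd (c := C) hf hc.aestronglyMeasurable (Eventually.of_forall hC)

theorem IsWeakDeriv.congr {L : ℝ} {k : ℕ} {f g f' g' : ℝ → ℝ} (h : IsWeakDeriv L k f g)
    (hf : f' =ᵐ[volume.restrict (Ioo 0 L)] f) (hg : g' =ᵐ[volume.restrict (Ioo 0 L)] g) :
    IsWeakDeriv L k f' g' := by
  refine ⟨Integrable.congr h.1 hf.symm, Integrable.congr h.2.1 hg.symm, fun φ hφ => ?_⟩
  have e1 : ∫ x in Ioo 0 L, f' x * iteratedDeriv k φ x = ∫ x in Ioo 0 L, f x * iteratedDeriv k φ x :=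
    integral_congr_ae (hf.mul (ae_eq_refl (iteratedDeriv k φ)))
  have e2 : ∫ x in Ioo 0 L, g' x * φ x = ∫ x in Ioo 0 L, g x * φ x :=
    integral_congr_ae (hg.mul (ae_eq_refl φ))
  rw [e1, e2]
  exact h.2.2 φ hφ

theorem IsWeakDeriv.zero (L : ℝ) (k : ℕ) : IsWeakDeriv L k (0 : ℝ → ℝ) 0 := by
  refine ⟨integrable_zero _ _ _, integrable_zero _ _ _, fun φ _ => ?_⟩
  simp

theorem IsWeakDeriv.add {L : ℝ} {k : ℕ} {f g f' g' : ℝ → ℝ} (h : IsWeakDeriv L k f g)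
    (h' : IsWeakDeriv L k f' g') : IsWeakDeriv L k (f + f') (g + g') := by
  refine ⟨Integrable.add h.1 h'.1, Integrable.add h.2.1 h'.2.1, fun φ hφ => ?_⟩
  have e1 := integral_add (hφ.integrable_mul k h.1) (hφ.integrable_mul k h'.1)
  have e2 := integral_add (hφ.integrable_mul 0 h.2.1) (hφ.integrable_mul 0 h'.2.1)
  simp only [iteratedDeriv_zero] at e2
  simp only [Pi.add_apply, add_mul]
  rw [e1, e2, h.2.2 φ hφ, h'.2.2 φ hφ]
  ring

theorem IsWeakDeriv.smul {L : ℝ} {k : ℕ} {f g : ℝ → ℝ} (c : ℝ) (h : IsWeakDeriv L k f g) :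
    IsWeakDeriv L k (c • f) (c • g) := by
  refine ⟨Integrable.smul c h.1, Integrable.smul c h.2.1, fun φ hφ => ?_⟩
  simp only [Pi.smul_apply, smul_eq_mul, mul_assoc, integral_const_mul]
  rw [h.2.2 φ hφ]
  ring

/-- The Sobolev space `H^k(0,L)`. An element is the tuple `(f, f', …, f^(k))` of an `L²` function
and its weak derivatives, so the norm inherited from the `ℓ²` product is the usual `H^k` norm
`(∑ ‖f^(j)‖²)^(1/2)`. -/
def Sobolev (L : ℝ) (k : ℕ) : Submodule ℝ (PiLp 2 (fun _ : Fin (k + 1) => L2 L)) where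
  carrier := {F | ∀ j : Fin (k + 1), IsWeakDeriv L j (F 0) (F j)}
  add_mem' := by
    intro F G hF hG j
    exact ((hF j).add (hG j)).congr (Lp.coeFn_add _ _) (Lp.coeFn_add _ _)
  zero_mem' := by
    intro j
    exact (IsWeakDeriv.zero L j).congr (Lp.coeFn_zero _ _ _) (Lp.coeFn_zero _ _ _)
  smul_mem' := by
    intro c F hF j
    exact ((hF j).smul c).congr (Lp.coeFn_smul _ _) (Lp.coeFn_smul _ _)

/-- The `j`-th weak derivative `∂ₓʲ f ∈ L²(0,L)` of `f ∈ H^k(0,L)`, for `j ≤ k`. -/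
def dx {L : ℝ} {k : ℕ} (f : Sobolev L k) (j : Fin (k + 1)) : L2 L := f.1 j

/-- The continuous representative of `f` on `[0,L]` exists and takes the value `c` at `a`. -/
def HasTrace (L : ℝ) (f : ℝ → ℝ) (a c : ℝ) : Prop :=
  ∃ g : ℝ → ℝ, ContinuousOn g (Icc 0 L) ∧ f =ᵐ[volume.restrict (Ioo 0 L)] g ∧ g a = c

/-- The functions of `H^k(0,L)`, `k ≥ 2`, that are clamped at `0`: `v(0) = v_x(0) = 0`. For `k = 2`
this is `H²_*`, in general it is `H^k(0,L) ∩ H²_*`. -/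
def Clamped (L : ℝ) (k : ℕ) : Set (Sobolev L k) :=
  {v | HasTrace L (dx v 0) 0 0 ∧ HasTrace L (dx v 1) 0 0}

/-- The free-end conditions `v_xx(L) = v_xxx(L) = 0` for `v ∈ H⁴(0,L)`. -/
def FreeEnd (L : ℝ) (v : Sobolev L 4) : Prop :=
  HasTrace L (dx v 2) L 0 ∧ HasTrace L (dx v 3) L 0

/-- The domain `𝓓(𝓐)` of the cantilever operator. -/
def DomA (L : ℝ) : Set (Sobolev L 4) := {v | v ∈ Clamped L 4 ∧ FreeEnd L v}

/-- The `L²(0,L)` inner product. -/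
def ip (L : ℝ) (f g : ℝ → ℝ) : ℝ := ∫ x in Ioo 0 L, f x * g x

/-- `g` is the weak time derivative of `f` on `(0,T)`, for functions with values in `L²(0,L)`. -/
def IsTimeDeriv {L : ℝ} (T : ℝ) (f g : ℝ → L2 L) : Prop :=
  ∀ η : ℝ → ℝ, IsTest T η →
    ∫ t in Ioo 0 T, deriv η t • f t = -∫ t in Ioo 0 T, η t • g t

/-- The axial acceleration `u_tt(x) = -∫₀ˣ (w_xt² + w_x w_xtt) dξ`, at a fixed time, from
`w`, `w_t`, `w_tt`. -/
def axialAcc {L : ℝ} (w wt : Sobolev L 4) (wtt : Sobolev L 2) (x : ℝ) : ℝ :=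
  -∫ ξ in (0 : ℝ)..x, ((dx wt 1 ξ) ^ 2 + dx w 1 ξ * dx wtt 1 ξ)

/-- `w_x ∫ₓᴸ u_tt dξ`. -/
def inertiaFlux {L : ℝ} (w wt : Sobolev L 4) (wtt : Sobolev L 2) (x : ℝ) : ℝ :=
  dx w 1 x * ∫ ξ in x..L, axialAcc w wt wtt ξ

/-- The weak form of the damped full model (`σ = ι = 1`) at a fixed time, with test function
`φ`. -/
def WeakForm {L : ℝ} (D k₂ : ℝ) (p : L2 L) (w wt : Sobolev L 4) (wtt φ : Sobolev L 2) : Prop :=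
  ip L (dx wtt 0) (dx φ 0) + D * ip L (dx w 2) (dx φ 2) + k₂ * ip L (dx wt 2) (dx φ 2)
      + D * ip L (fun x => dx w 2 x * dx w 1 x) (fun x => dx w 1 x * dx φ 2 x)
      + D * ip L (fun x => dx w 2 x * dx w 1 x) (fun x => dx w 2 x * dx φ 1 x)
      - ip L (inertiaFlux w wt wtt) (dx φ 1)
    = ip L p (dx φ 0)

/-- `w`, with `w_t = wt` and `w_tt = wtt`, is a solution on `(0,T)` of the damped full model
(`σ = ι = 1`) in the sense of the weak form, with the regularity
`w, w_t ∈ L²(0,T;X)` and `w_tt ∈ L²(0,T;H²_*)`, for a closed subspace `X` of `H⁴(0,L)`.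
The functions of time are classes modulo null sets; accordingly the initial conditions are
essential limits as `t → 0⁺`. -/
structure IsSolutionIn {L : ℝ} (X : Set (Sobolev L 4)) (D k₂ T : ℝ) (p : ℝ → L2 L)
    (w₀ : Sobolev L 2) (w₁ : L2 L) (w wt : ℝ → Sobolev L 4) (wtt : ℝ → Sobolev L 2) : Prop where
  memLp_w : MemLp w 2 (volume.restrict (Ioo 0 T))
  memLp_wt : MemLp wt 2 (volume.restrict (Ioo 0 T))
  memLp_wtt : MemLp wtt 2 (volume.restrict (Ioo 0 T))
  w_mem : ∀ᵐ t ∂(volume.restrict (Ioo 0 T)), w t ∈ X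
  wt_mem : ∀ᵐ t ∂(volume.restrict (Ioo 0 T)), wt t ∈ X
  wtt_mem : ∀ᵐ t ∂(volume.restrict (Ioo 0 T)), wtt t ∈ Clamped L 2
  timeDeriv_w : IsTimeDeriv T (fun t => dx (w t) 0) (fun t => dx (wt t) 0)
  timeDeriv_wt : IsTimeDeriv T (fun t => dx (wt t) 0) (fun t => dx (wtt t) 0)
  weakForm : ∀ φ ∈ Clamped L 2, ∀ᵐ t ∂(volume.restrict (Ioo 0 T)),
    WeakForm D k₂ (p t) (w t) (wt t) (wtt t) φ
  init_w : ∀ χ ∈ Clamped L 2,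
    Tendsto (fun t => D * ip L (dx (w t) 2) (dx χ 2)) (𝓝[>] 0 ⊓ ae volume)
      (𝓝 (D * ip L (dx w₀ 2) (dx χ 2)))
  init_wt : ∀ ψ : L2 L,
    Tendsto (fun t => ip L (dx (wt t) 0) ψ) (𝓝[>] 0 ⊓ ae volume) (𝓝 (ip L w₁ ψ))

/-- Strong solutions of the damped full model: `w, w_t ∈ L²(0,T;𝓓(𝓐))`,
`w_tt ∈ L²(0,T;H²_*)`. -/
def IsStrongSolution {L : ℝ} (D k₂ T : ℝ) (p : ℝ → L2 L)
    (w₀ : Sobolev L 2) (w₁ : L2 L) (w wt : ℝ → Sobolev L 4) (wtt : ℝ → Sobolev L 2) : Prop :=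
  IsSolutionIn (DomA L) D k₂ T p w₀ w₁ w wt wtt

/-- The equation
`w_tt + D ∂ₓ⁴w + k₂ ∂ₓ⁴w_t - D ∂ₓ[w_xx² w_x] + D ∂ₓₓ[w_xx w_x²] + ∂ₓ[w_x ∫ₓᴸ u_tt] = p`
holds in `L²(0,T;L²(0,L))`: `S₁`, `S₂`, `N` are the three nonlinear derivatives (in the weak
sense), each belongs to `L²(0,T;L²(0,L))`, and the two sides agree there. -/
def SolvesPDE {L : ℝ} (D k₂ T : ℝ) (p : ℝ → L2 L)
    (w wt : ℝ → Sobolev L 4) (wtt : ℝ → Sobolev L 2) : Prop :=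
  ∃ S₁ S₂ N : ℝ → L2 L,
    MemLp S₁ 2 (volume.restrict (Ioo 0 T)) ∧ MemLp S₂ 2 (volume.restrict (Ioo 0 T)) ∧
    MemLp N 2 (volume.restrict (Ioo 0 T)) ∧
    ∀ᵐ t ∂(volume.restrict (Ioo 0 T)),
      IsWeakDeriv L 1 (fun x => (dx (w t) 2 x) ^ 2 * dx (w t) 1 x) (S₁ t) ∧
      IsWeakDeriv L 2 (fun x => dx (w t) 2 x * (dx (w t) 1 x) ^ 2) (S₂ t) ∧
      IsWeakDeriv L 1 (inertiaFlux (w t) (wt t) (wtt t)) (N t) ∧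
      dx (wtt t) 0 + D • dx (w t) 4 + k₂ • dx (wt t) 4 - D • S₁ t + D • S₂ t + N t = p t

/-- The boundary and initial conditions, in the pointwise-in-time sense: `w` has a representative
in `C([0,T];H⁴(0,L))` that satisfies all four cantilever boundary conditions at every
`t ∈ [0,T]` and equals `w₀` at `t = 0`, and `w_t` has a representative in `C([0,T];L²(0,L))`
that equals `w₁` at `t = 0`. -/
def SatisfiesBoundaryAndInitial {L : ℝ} (T : ℝ) (w₀ : Sobolev L 2) (w₁ : L2 L)
    (w wt : ℝ → Sobolev L 4) : Prop :=
  (∃ v : ℝ → Sobolev L 4, ContinuousOn v (Icc 0 T) ∧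
      v =ᵐ[volume.restrict (Ioo 0 T)] w ∧
      (∀ t ∈ Icc 0 T, v t ∈ Clamped L 4 ∧ FreeEnd L (v t)) ∧
      dx (v 0) 0 = dx w₀ 0) ∧
  (∃ v' : ℝ → L2 L, ContinuousOn v' (Icc 0 T) ∧
      v' =ᵐ[volume.restrict (Ioo 0 T)] (fun t => dx (wt t) 0) ∧ v' 0 = w₁)

end Cantilever

end

noncomputable section

namespace Cantilever

/-! ### Test functions -/

/-! At almost every time the weak form holds for all test functions at once (`ae_forall_weakForm`),
so it can be read as a stationary problem in `x`; this is `stationary`. Let `M = D w_xx + k₂ w_xxt +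
D w_xx w_x²`, `Q = D w_xx² w_x` and let `F` be the inertial flux. Integrating by parts against a
smooth `φ` with `φ(0) = φ'(0) = 0` gives `∫ F φ' = M(L) φ'(L) + (Q - M_x)(L) φ(L) - ∫ N φ`, where
`N` is the residual of all the other terms of the equation. Compactly supported `φ` show that `F`
has weak derivative `N`, which is the equation. Thus the derivative of the flux is never computed,
and its square integrability in time is inherited from the other terms.

Since `F(L) = 0`, integrating `∫ F φ'` by parts as well leaves only the boundary terms, and `φ =
x²`, `x³` yield the natural conditions `M(L) = 0` and `(Q - M_x)(L) = 0`. Because of the damping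
they are not the free-end conditions but differential equations in time for the traces: `k₂ w_xxt =
-D(1 + w_x²) w_xx` and `k₂ w_xxxt = -D(1 + w_x²) w_xxx - D w_xx² w_x` at `x = L`. With zero initial
traces Grönwall's inequality gives first `w_xx(L,t) = 0`, then `w_xxx(L,t) = 0`; this is
`freeEnd_rep`, needed for (b). For strong solutions these conditions hold at almost every time and
pass to all times by continuity, as `DomA` is closed.

Continuity in time comes from `exists_ae_eq_add_integral`: `w` is a.e. equal to `c + ∫₀ᵗ w_t`, a
Bochner integral in `H⁴`. The constant `c` is identified with the initial displacement in
`initial_displacement`. -/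

theorem exists_Icc_of_isCompact {a : ℝ} (ha : 0 < a) {K : Set ℝ} (hK : IsCompact K)
    (h : K ⊆ Ioo 0 a) : ∃ c d, 0 < c ∧ c ≤ d ∧ d < a ∧ K ⊆ Icc c d := by
  rcases K.eq_empty_or_nonempty with rfl | hne
  · exact ⟨a / 2, a / 2, by linarith, le_rfl, by linarith, empty_subset _⟩
  · refine ⟨sInf K, sSup K, (h (hK.sInf_mem hne)).1, ?_, (h (hK.sSup_mem hne)).2, fun x hx => ?_⟩
    · exact csInf_le hK.bddBelow (hK.sSup_mem hne)
    · exact ⟨csInf_le hK.bddBelow hx, le_csSup hK.bddAbove hx⟩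

theorem IsTest.derivative {a : ℝ} {φ : ℝ → ℝ} (h : IsTest a φ) : IsTest a (deriv φ) := by
  refine ⟨?_, h.2.1.deriv, tsupport_deriv_subset.trans h.2.2⟩
  exact (contDiff_infty_iff_deriv.1 h.1).2

theorem IsTest.sub {a : ℝ} {φ ψ : ℝ → ℝ} (h : IsTest a φ) (h' : IsTest a ψ) :
    IsTest a (fun x => φ x - ψ x) :=
  ⟨h.1.sub h'.1, h.2.1.sub h'.2.1, (tsupport_sub φ ψ).trans (union_subset h.2.2 h'.2.2)⟩

theorem IsTest.const_mul {a : ℝ} {φ : ℝ → ℝ} (c : ℝ) (h : IsTest a φ) :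
    IsTest a (fun x => c * φ x) :=
  ⟨contDiff_const.mul h.1, h.2.1.mul_left,
    (tsupport_mul_subset_right (f := fun _ => c) (g := φ)).trans h.2.2⟩

theorem IsTest.eq_zero {a : ℝ} {φ : ℝ → ℝ} (h : IsTest a φ) {x : ℝ} (hx : x ∉ Ioo 0 a) :
    φ x = 0 :=
  image_eq_zero_of_notMem_tsupport fun h' => hx (h.2.2 h')

theorem IsTest.setIntegral_smul {E : Type*} [NormedAddCommGroup E] [NormedSpace ℝ E] {a : ℝ}
    {φ : ℝ → ℝ} (h : IsTest a φ) (f : ℝ → E) :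
    ∫ x in Ioo 0 a, φ x • f x = ∫ x, φ x • f x :=
  setIntegral_eq_integral_of_forall_compl_eq_zero fun x hx => by simp [h.eq_zero hx]

theorem IsTest.integrable_smul {E : Type*} [NormedAddCommGroup E] [NormedSpace ℝ E] {a : ℝ}
    {φ : ℝ → ℝ} (hφ : IsTest a φ) {f : ℝ → E} (hf : IntegrableOn f (Ioo 0 a)) :
    IntegrableOn (fun x => φ x • f x) (Ioo 0 a) := by
  obtain ⟨C, hC⟩ := hφ.2.1.exists_bound_of_continuous hφ.1.continuous
  exact Integrable.bdd_smul hf C hφ.1.continuous.aestronglyMeasurable (Eventually.of_forall hC)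

theorem exists_isTest_integral_eq_one {a : ℝ} (ha : 0 < a) :
    ∃ ψ, IsTest a ψ ∧ ∫ x in Ioo 0 a, ψ x = 1 := by
  let f : ContDiffBump (a / 2) := ⟨a / 8, a / 4, by linarith, by linarith⟩
  have ht : IsTest a (f.normed volume) := by
    refine ⟨f.contDiff_normed, f.hasCompactSupport_normed, ?_⟩
    rw [f.tsupport_normed_eq, Real.closedBall_eq_Icc]
    intro x hx
    simp only [f, mem_Icc] at hx
    exact ⟨by linarith, by linarith⟩
  refine ⟨_, ht, ?_⟩
  rw [← f.integral_normed (μ := volume)]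
  simpa using ht.setIntegral_smul (fun _ => (1 : ℝ))

/-- The primitive from `0` vanishes to the left of the support of `φ` because `φ` does, and to the
right because the total integral is zero. -/
theorem IsTest.exists_antideriv {a : ℝ} (ha : 0 < a) {φ : ℝ → ℝ} (h : IsTest a φ)
    (h0 : ∫ x in Ioo 0 a, φ x = 0) : ∃ Φ, IsTest a Φ ∧ deriv Φ = φ := by
  obtain ⟨c, d, hc, hcd, hd, hK⟩ := exists_Icc_of_isCompact ha h.2.1 h.2.2
  have hz : ∀ x, x ∉ Icc c d → φ x = 0 := fun x hx =>
    image_eq_zero_of_notMem_tsupport fun h' => hx (hK h')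
  have hcont : Continuous φ := h.1.continuous
  have hder : ∀ x, HasDerivAt (fun x => ∫ s in (0 : ℝ)..x, φ s) (φ x) x := fun x =>
    intervalIntegral.integral_hasDerivAt_right (hcont.intervalIntegrable _ _)
      hcont.stronglyMeasurable.stronglyMeasurableAtFilter hcont.continuousAt
  have hd' : deriv (fun x => ∫ s in (0 : ℝ)..x, φ s) = φ := funext fun x => (hder x).deriv
  have hout : ∀ x, x ∉ Icc c d → ∫ s in (0 : ℝ)..x, φ s = 0 := by
    intro x hx
    rcases lt_or_ge x c with hxc | hxc
    · refine intervalIntegral.integral_zero_ae (Eventually.of_forall fun s hs => hz s fun hs' => ?_)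
      rcases le_total 0 x with h1 | h1
      · rw [uIoc_of_le h1] at hs
        linarith [hs.2, hs'.1]
      · rw [uIoc_of_ge h1] at hs
        linarith [hs.2, hs'.1]
    · have hxd : d < x := by
        by_contra hcon
        exact hx ⟨hxc, not_lt.1 hcon⟩
      have e1 : ∫ s in (0 : ℝ)..a, φ s = 0 := by
        rw [intervalIntegral.integral_of_le ha.le, integral_Ioc_eq_integral_Ioo, h0]
      have e2 : ∫ s in a..x, φ s = 0 := by
        refine intervalIntegral.integral_zero_ae
          (Eventually.of_forall fun s hs => hz s fun hs' => ?_)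
        have hs1 := hs.1
        have : d < min a x := lt_min hd hxd
        linarith [hs'.2]
      rw [← intervalIntegral.integral_add_adjacent_intervals (b := a)
        (hcont.intervalIntegrable _ _) (hcont.intervalIntegrable _ _), e1, e2, add_zero]
  have hts : tsupport (fun x => ∫ s in (0 : ℝ)..x, φ s) ⊆ Icc c d := by
    refine closure_minimal (fun x hx => ?_) isClosed_Icc
    by_contra hcon
    exact hx (hout x hcon)
  refine ⟨_, ⟨?_, ?_, ?_⟩, hd'⟩
  · rw [contDiff_infty_iff_deriv, hd']
    exact ⟨fun x => (hder x).differentiableAt, h.1⟩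
  · exact isCompact_Icc.of_isClosed_subset (isClosed_tsupport _) hts
  · exact hts.trans fun x hx => ⟨by linarith [hx.1], by linarith [hx.2]⟩

/-- **du Bois-Reymond lemma**: a function with vanishing weak derivative is a.e. constant. -/
theorem ae_const_of_integral_deriv_smul_eq_zero {E : Type*} [NormedAddCommGroup E]
    [NormedSpace ℝ E] [CompleteSpace E] {a : ℝ} (ha : 0 < a) {h : ℝ → E}
    (hi : IntegrableOn h (Ioo 0 a))
    (hz : ∀ η, IsTest a η → ∫ x in Ioo 0 a, deriv η x • h x = 0) :
    ∃ c : E, h =ᵐ[volume.restrict (Ioo 0 a)] fun _ => c := by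
  obtain ⟨ψ, hψ, hψ1⟩ := exists_isTest_integral_eq_one ha
  have hintr : ∀ {φ : ℝ → ℝ}, IsTest a φ → IntegrableOn φ (Ioo 0 a) := fun hφ =>
    (hφ.1.continuous.integrable_of_hasCompactSupport hφ.2.1).integrableOn
  refine ⟨∫ x in Ioo 0 a, ψ x • h x, ?_⟩
  set c := ∫ x in Ioo 0 a, ψ x • h x with hc
  have hci : IntegrableOn (fun _ : ℝ => c) (Ioo 0 a) := integrableOn_const (by simp)
  have hd : IntegrableOn (fun x => h x - c) (Ioo 0 a) := hi.sub hci
  have key : ∀ᵐ x, x ∈ Ioo 0 a → h x - c = 0 := by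
    refine isOpen_Ioo.ae_eq_zero_of_integral_contDiff_smul_eq_zero hd.locallyIntegrableOn ?_
    intro φ h1 h2 h3
    have hφ : IsTest a φ := ⟨h1, h2, h3⟩
    rw [← hφ.setIntegral_smul]
    set m := ∫ x in Ioo 0 a, φ x
    -- Subtracting `m ψ` makes the mean zero, so this is the derivative of a test function and the
    -- hypothesis applies.
    have hη : IsTest a (fun x => φ x - m * ψ x) := hφ.sub (hψ.const_mul m)
    obtain ⟨Φ, hΦ, hΦ'⟩ := hη.exists_antideriv ha (by
      rw [integral_sub (hintr hφ) ((hintr hψ).const_mul m), integral_const_mul, hψ1]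
      simp [m])
    have := hz Φ hΦ
    rw [hΦ'] at this
    simp only [sub_smul, mul_smul] at this
    have hm : IntegrableOn (fun x => m • ψ x • h x) (Ioo 0 a) :=
      Integrable.smul m (hψ.integrable_smul hi)
    rw [integral_sub (hφ.integrable_smul hi) hm, integral_smul, ← hc, sub_eq_zero] at this
    simp only [smul_sub]
    rw [integral_sub (hφ.integrable_smul hi) (hφ.integrable_smul hci), this, integral_smul_const, sub_self]
  rw [EventuallyEq, ae_restrict_iff' measurableSet_Ioo]
  filter_upwards [key] with x hx hx'
  exact sub_eq_zero.1 (hx hx')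

/-! ### Absolutely continuous functions -/

/-- `F` is absolutely continuous on `[0,L]` with derivative `f`. -/
structure IsPrim (L : ℝ) (F f : ℝ → ℝ) : Prop where
  ac : AbsolutelyContinuousOnInterval F 0 L
  hasDerivAt : ∀ᵐ x ∂(volume.restrict (Ioo 0 L)), HasDerivAt F (f x) x

namespace IsPrim
variable {L : ℝ} {F f G g : ℝ → ℝ}

theorem congr_right (h : IsPrim L F f) (hg : g =ᵐ[volume.restrict (Ioo 0 L)] f) :
    IsPrim L F g := by
  refine ⟨h.ac, ?_⟩
  filter_upwards [h.hasDerivAt, hg] with x h1 h2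
  rwa [h2]

theorem add (hF : IsPrim L F f) (hG : IsPrim L G g) :
    IsPrim L (fun x => F x + G x) (fun x => f x + g x) := by
  refine ⟨hF.ac.add hG.ac, ?_⟩
  filter_upwards [hF.hasDerivAt, hG.hasDerivAt] with x h1 h2 using h1.add h2

theorem mul (hF : IsPrim L F f) (hG : IsPrim L G g) :
    IsPrim L (fun x => F x * G x) (fun x => f x * G x + F x * g x) := by
  refine ⟨hF.ac.fun_mul hG.ac, ?_⟩
  filter_upwards [hF.hasDerivAt, hG.hasDerivAt] with x h1 h2 using h1.mul h2

theorem const_mul (c : ℝ) (hF : IsPrim L F f) : IsPrim L (fun x => c * F x) (fun x => c * f x) := by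
  refine ⟨hF.ac.const_mul c, ?_⟩
  filter_upwards [hF.hasDerivAt] with x h1 using h1.const_mul c

theorem of_contDiff (h : ContDiff ℝ ∞ F) : IsPrim L F (deriv F) :=
  ⟨(h.contDiffOn.of_le (by exact_mod_cast le_top)).absolutelyContinuousOnInterval, Eventually.of_forall fun x =>
      (h.differentiable (by simp) x).hasDerivAt⟩

theorem of_integral (hL : 0 ≤ L) (hf : IntegrableOn f (Ioo 0 L)) (c : ℝ) :
    IsPrim L (fun x => c + ∫ s in (0 : ℝ)..x, f s) f := by
  have hi : IntervalIntegrable f volume 0 L := by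
    rwa [intervalIntegrable_iff_integrableOn_Ioo_of_le hL]
  have hc : ContDiff ℝ ∞ fun _ : ℝ => c := contDiff_const
  refine ⟨(of_contDiff hc).ac.add
    (hi.absolutelyContinuousOnInterval_intervalIntegral left_mem_uIcc), ?_⟩
  rw [ae_restrict_iff' measurableSet_Ioo]
  filter_upwards [hi.ae_hasDerivAt_integral] with x hx hx'
  refine (hx ?_ 0 left_mem_uIcc).const_add c
  rw [uIcc_of_le hL]
  exact Ioo_subset_Icc_self hx'

theorem continuousOn (hL : 0 ≤ L) (hF : IsPrim L F f) : ContinuousOn F (Icc 0 L) := by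
  have := hF.ac.continuousOn
  rwa [uIcc_of_le hL] at this

theorem deriv_ae_eq (hF : IsPrim L F f) : deriv F =ᵐ[volume.restrict (Ioo 0 L)] f := by
  filter_upwards [hF.hasDerivAt] with x hx using hx.deriv

theorem integrableOn_deriv (hL : 0 ≤ L) (hF : IsPrim L F f) : IntegrableOn f (Ioo 0 L) := by
  have := hF.ac.intervalIntegrable_deriv
  rw [intervalIntegrable_iff_integrableOn_Ioo_of_le hL] at this
  exact Integrable.congr this hF.deriv_ae_eq

theorem integrableOn (hL : 0 ≤ L) (hF : IsPrim L F f) : IntegrableOn F (Ioo 0 L) :=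
  ((hF.continuousOn hL).integrableOn_Icc).mono_set Ioo_subset_Icc_self

theorem integral_eq (hL : 0 ≤ L) (hF : IsPrim L F f) : ∫ x in Ioo 0 L, f x = F L - F 0 := by
  rw [← hF.ac.integral_deriv_eq_sub, intervalIntegral.integral_of_le hL,
    integral_Ioc_eq_integral_Ioo, integral_congr_ae hF.deriv_ae_eq]

/-- Integration by parts. -/
theorem integral_mul_eq (hL : 0 ≤ L) (hF : IsPrim L F f) (hG : IsPrim L G g) :
    ∫ x in Ioo 0 L, F x * g x = F L * G L - F 0 * G 0 - ∫ x in Ioo 0 L, f x * G x := by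
  rw [← (hF.mul hG).integral_eq hL, integral_add, add_sub_cancel_left]
  · have := (hF.integrableOn_deriv hL).mul_continuousOn_of_subset (hG.continuousOn hL)
      measurableSet_Ioo isCompact_Icc Ioo_subset_Icc_self
    exact this
  · exact (hG.integrableOn_deriv hL).continuousOn_mul_of_subset (hF.continuousOn hL)
      isCompact_Icc measurableSet_Ioo Ioo_subset_Icc_self

theorem isWeakDeriv (hL : 0 ≤ L) (hF : IsPrim L F f) : IsWeakDeriv L 1 F f := by
  refine ⟨hF.integrableOn hL, hF.integrableOn_deriv hL, fun φ hφ => ?_⟩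
  rw [iteratedDeriv_one, hF.integral_mul_eq hL (of_contDiff hφ.1), hφ.eq_zero (by simp),
    hφ.eq_zero (by simp)]
  ring

end IsPrim

/-- Continuous functionals separate points, and they commute with the integrals, which leaves scalar
integration by parts. -/
theorem integral_deriv_smul_integral {E : Type*} [NormedAddCommGroup E] [NormedSpace ℝ E]
    [CompleteSpace E] {a : ℝ} (ha : 0 ≤ a) {g : ℝ → E} (hg : IntegrableOn g (Ioo 0 a))
    {η : ℝ → ℝ} (hη : IsTest a η) (hi : IntegrableOn (fun t => ∫ s in (0 : ℝ)..t, g s) (Ioo 0 a)) :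
    ∫ t in Ioo 0 a, deriv η t • ∫ s in (0 : ℝ)..t, g s = -∫ t in Ioo 0 a, η t • g t := by
  rw [SeparatingDual.eq_iff_forall_dual_eq (R := ℝ)]
  intro ℓ
  rw [map_neg, ← ℓ.integral_comp_comm (hη.derivative.integrable_smul hi), ← ℓ.integral_comp_comm (hη.integrable_smul hg)]
  have hp := IsPrim.of_integral ha (ℓ.integrable_comp hg) 0
  have h := (hp.isWeakDeriv ha).2.2 η hη
  simp only [map_smul, smul_eq_mul]
  rw [iteratedDeriv_one] at h
  simp only [zero_add, pow_one, neg_mul, one_mul] at h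
  rw [setIntegral_congr_fun measurableSet_Ioo
    (g := fun t => (∫ s in (0 : ℝ)..t, ℓ (g s)) * deriv η t), h]
  · simp only [mul_comm]
  · intro t ht
    have : IntervalIntegrable g volume 0 t := by
      rw [intervalIntegrable_iff_integrableOn_Ioo_of_le ht.1.le]
      exact hg.mono_set (Ioo_subset_Ioo_right ht.2.le)
    simp only [ℓ.intervalIntegral_comp_comm this, mul_comm]

/-! ### Weak derivatives -/

theorem continuousOn_integral {E : Type*} [NormedAddCommGroup E] [NormedSpace ℝ E] {a : ℝ}
    (ha : 0 ≤ a) {g : ℝ → E} (hg : IntegrableOn g (Ioo 0 a)) :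
    ContinuousOn (fun t => ∫ s in (0 : ℝ)..t, g s) (Icc 0 a) := by
  have := intervalIntegral.continuousOn_primitive_interval (f := g) (μ := volume) (a := 0) (b := a)
    (by rwa [uIcc_of_le ha, integrableOn_Icc_iff_integrableOn_Ioo])
  rwa [uIcc_of_le ha] at this

namespace IsWeakDeriv
variable {L : ℝ} {f g h : ℝ → ℝ}

/-- The difference of `f` and the primitive of `g` has zero weak derivative, hence is constant by
the du Bois-Reymond lemma. -/
theorem exists_isPrim (hL : 0 < L) (hw : IsWeakDeriv L 1 f g) :
    ∃ F, f =ᵐ[volume.restrict (Ioo 0 L)] F ∧ IsPrim L F g := by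
  have hp := IsPrim.of_integral hL.le hw.2.1 0
  have hi := hp.integrableOn hL.le
  obtain ⟨c, hc⟩ := ae_const_of_integral_deriv_smul_eq_zero hL (hw.1.sub hi) fun η hη => by
    have e1 := hw.2.2 η hη
    have e2 := (hp.isWeakDeriv hL.le).2.2 η hη
    have e3 := integral_sub (hη.integrable_mul 1 hw.1) (hη.integrable_mul 1 hi)
    simp only [iteratedDeriv_one] at e1 e2 e3
    simp only [Pi.sub_apply, smul_eq_mul, mul_comm (deriv η _), sub_mul]
    rw [e3, e1, e2, sub_self]
  refine ⟨_, ?_, IsPrim.of_integral hL.le hw.2.1 c⟩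
  filter_upwards [hc] with x hx
  simp only [Pi.sub_apply] at hx
  linarith

theorem trans {i : ℕ} (h1 : IsWeakDeriv L i f g) (h2 : IsWeakDeriv L 1 g h) :
    IsWeakDeriv L (i + 1) f h := by
  refine ⟨h1.1, h2.2.1, fun φ hφ => ?_⟩
  have e2 := h2.2.2 φ hφ
  rw [iteratedDeriv_one] at e2
  rw [iteratedDeriv_succ', h1.2.2 _ hφ.derivative, e2]
  ring

/-- `Sobolev` refers every derivative to the function itself; this recovers the first-order steps
between consecutive derivatives. The reason is that `φ'` is again a test function. -/
theorem of_succ {i : ℕ} (h1 : IsWeakDeriv L i f g) (h2 : IsWeakDeriv L (i + 1) f h) :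
    IsWeakDeriv L 1 g h := by
  refine ⟨h1.2.1, h2.2.1, fun φ hφ => ?_⟩
  have e1 := h1.2.2 _ hφ.derivative
  have e2 := h2.2.2 φ hφ
  rw [iteratedDeriv_succ', e1, pow_succ, mul_assoc] at e2
  rw [iteratedDeriv_one, pow_one]
  exact mul_left_cancel₀ (pow_ne_zero i (by norm_num)) e2

theorem unique {i : ℕ} (h1 : IsWeakDeriv L i f g) (h2 : IsWeakDeriv L i f h) :
    g =ᵐ[volume.restrict (Ioo 0 L)] h := by
  have key : ∀ᵐ x, x ∈ Ioo 0 L → g x - h x = 0 := by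
    refine isOpen_Ioo.ae_eq_zero_of_integral_contDiff_smul_eq_zero
      (IntegrableOn.locallyIntegrableOn (Integrable.sub h1.2.1 h2.2.1)) ?_
    intro φ a1 a2 a3
    have hφ : IsTest L φ := ⟨a1, a2, a3⟩
    rw [← hφ.setIntegral_smul]
    have e1 := h1.2.2 φ hφ
    rw [h2.2.2 φ hφ] at e1
    have e2 := mul_left_cancel₀ (pow_ne_zero i (by norm_num)) e1
    have e3 := integral_sub (hφ.integrable_mul 0 h1.2.1) (hφ.integrable_mul 0 h2.2.1)
    simp only [iteratedDeriv_zero] at e3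
    simp only [smul_eq_mul, mul_comm (φ _), sub_mul]
    rw [e3, e2, sub_self]
  rw [EventuallyEq, ae_restrict_iff' measurableSet_Ioo]
  filter_upwards [key] with x hx hx'
  exact sub_eq_zero.1 (hx hx')

end IsWeakDeriv

/-! ### Sobolev spaces -/

variable {L : ℝ} {k : ℕ}

theorem ip_eq_inner (f g : L2 L) : ip L f g = inner ℝ f g := by
  rw [L2.inner_def]
  exact integral_congr_ae (Eventually.of_forall fun x => by simp [mul_comm])

theorem ip_congr {f f' g g' : ℝ → ℝ} (hf : f =ᵐ[volume.restrict (Ioo 0 L)] f')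
    (hg : g =ᵐ[volume.restrict (Ioo 0 L)] g') : ip L f g = ip L f' g' :=
  integral_congr_ae (hf.mul hg)

theorem memLp_of_continuousOn {f : ℝ → ℝ} (hf : ContinuousOn f (Icc 0 L)) (p : ENNReal) :
    MemLp f p (volume.restrict (Ioo 0 L)) := by
  obtain ⟨C, hC⟩ := isCompact_Icc.exists_bound_of_continuousOn hf
  refine MemLp.of_bound ((hf.mono Ioo_subset_Icc_self).aestronglyMeasurable measurableSet_Ioo) C ?_
  exact ae_restrict_of_forall_mem measurableSet_Ioo fun x hx => hC x (Ioo_subset_Icc_self hx)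

/-- The class in `L²(0,L)` of a continuous function. -/
def contL2 (L : ℝ) (f : ℝ → ℝ) (hf : Continuous f) : L2 L :=
  (memLp_of_continuousOn hf.continuousOn 2).toLp f

theorem coeFn_contL2 (f : ℝ → ℝ) (hf : Continuous f) :
    contL2 L f hf =ᵐ[volume.restrict (Ioo 0 L)] f :=
  MemLp.coeFn_toLp _

theorem L2.integrableOn (f : L2 L) : IntegrableOn f (Ioo 0 L) :=
  (Lp.memLp f).integrable (by norm_num)

theorem IsTest.continuous_iteratedDeriv {a : ℝ} {φ : ℝ → ℝ} (h : IsTest a φ) (j : ℕ) :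
    Continuous (iteratedDeriv j φ) :=
  h.1.continuous_iteratedDeriv j (by exact_mod_cast le_top)

theorem isWeakDeriv_iff_inner (f g : L2 L) (j : ℕ) :
    IsWeakDeriv L j f g ↔ ∀ φ (h : IsTest L φ),
      inner ℝ (contL2 L _ (h.continuous_iteratedDeriv j)) f
        = (-1) ^ j * inner ℝ (contL2 L _ h.1.continuous) g := by
  have e : ∀ (u : L2 L) (ψ : ℝ → ℝ) (hψ : Continuous ψ),
      inner ℝ (contL2 L ψ hψ) u = ∫ x in Ioo 0 L, u x * ψ x := by
    intro u ψ hψ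
    rw [real_inner_comm, ← ip_eq_inner]
    exact ip_congr (ae_eq_refl _) (coeFn_contL2 _ _)
  simp only [e]
  exact ⟨fun h => h.2.2, fun h => ⟨L2.integrableOn f, L2.integrableOn g, h⟩⟩

/-- Each defining identity is an equality of continuous functionals of the tuple. The resulting
completeness is what Bochner integration in `H⁴` requires. -/
theorem isClosed_sobolev : IsClosed (Sobolev L k : Set (PiLp 2 (fun _ : Fin (k + 1) => L2 L))) := by
  have : (Sobolev L k : Set (PiLp 2 (fun _ : Fin (k + 1) => L2 L)))
      = ⋂ j : Fin (k + 1), ⋂ φ : ℝ → ℝ, ⋂ h : IsTest L φ,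
        {F | inner ℝ (contL2 L _ (h.continuous_iteratedDeriv j)) (F 0)
          = (-1) ^ (j : ℕ) * inner ℝ (contL2 L _ h.1.continuous) (F j)} := by
    ext F
    simp only [mem_iInter, mem_ofPred_eq]
    exact forall_congr' fun j => isWeakDeriv_iff_inner _ _ _
  rw [this]
  refine isClosed_iInter fun j => isClosed_iInter fun φ => isClosed_iInter fun h =>
    isClosed_eq ?_ ?_
  · exact continuous_const.inner (PiLp.continuous_apply 2 _ 0)
  · exact continuous_const.mul (continuous_const.inner (PiLp.continuous_apply 2 _ j))

instance : CompleteSpace (Sobolev L k) := isClosed_sobolev.completeSpace_coe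

instance : SecondCountableTopology (L2 L) :=
  haveI : Fact ((2 : ENNReal) ≠ ⊤) := ⟨by norm_num⟩
  inferInstance

/-- Provides the countable dense family of test functions in `ae_forall_weakForm`. -/
instance : SecondCountableTopology (Sobolev L k) :=
  haveI : SecondCountableTopology (PiLp 2 (fun _ : Fin (k + 1) => L2 L)) :=
    inferInstance
  inferInstance

/-- `∂ₓʲ` as a continuous linear map. -/
def dxL (L : ℝ) (k : ℕ) (j : Fin (k + 1)) : Sobolev L k →L[ℝ] L2 L :=
  (PiLp.proj 2 (fun _ : Fin (k + 1) => L2 L) j).comp (Sobolev L k).subtypeL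

@[simp] theorem dxL_apply (v : Sobolev L k) (j : Fin (k + 1)) : dxL L k j v = dx v j := rfl

theorem dx_add (v w : Sobolev L k) (j : Fin (k + 1)) : dx (v + w) j = dx v j + dx w j := rfl

theorem Sobolev.ext' {v w : Sobolev L k} (h : ∀ j, dx v j = dx w j) : v = w :=
  Subtype.ext (PiLp.ext h)

theorem isWeakDeriv_dx (v : Sobolev L k) (j : Fin (k + 1)) :
    IsWeakDeriv L j (dx v 0) (dx v j) := v.2 j

/-- Weak derivatives are unique. Hence a time derivative tested only in `L²` determines one in `H⁴`.
-/
theorem dx_zero_injective : Function.Injective fun v : Sobolev L k => dx v 0 := by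
  intro v w h
  refine Sobolev.ext' fun j => Lp.ext ?_
  have h1 := isWeakDeriv_dx v j
  rw [show dx v 0 = dx w 0 from h] at h1
  exact h1.unique (isWeakDeriv_dx w j)

theorem isWeakDeriv_dx_succ (v : Sobolev L k) (j : Fin k) :
    IsWeakDeriv L 1 (dx v j.castSucc) (dx v j.succ) := by
  have h2 := isWeakDeriv_dx v j.succ
  rw [Fin.val_succ] at h2
  exact (isWeakDeriv_dx v j.castSucc).of_succ h2

theorem exists_isPrim_dx (hL : 0 < L) (v : Sobolev L k) (j : Fin k) :
    ∃ F, dx v j.castSucc =ᵐ[volume.restrict (Ioo 0 L)] F ∧ IsPrim L F (dx v j.succ) :=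
  (isWeakDeriv_dx_succ v j).exists_isPrim hL

/-- For `a ∈ {0, L}`: the value of `∂ₓʲ v` at `a`. -/
def endTrace (L : ℝ) (k : ℕ) (j : Fin k) (a : ℝ) : Sobolev L k →L[ℝ] ℝ :=
  L⁻¹ • ((innerSL ℝ (contL2 L (fun _ => 1) continuous_const)).comp (dxL L k j.castSucc)
    + (innerSL ℝ (contL2 L (fun x => x - (L - a)) (by fun_prop))).comp (dxL L k j.succ))

/-- Integration by parts with the weight `x - (L - a)` gives `∫ F + ∫ F' (x - (L - a)) = a F(L) + (L
- a) F(0)`, which is `L F(a)` when `a` is an endpoint. -/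
theorem endTrace_eq (hL : 0 < L) (v : Sobolev L k) (j : Fin k) {a : ℝ} (ha : a = 0 ∨ a = L)
    {F : ℝ → ℝ} (hF : dx v j.castSucc =ᵐ[volume.restrict (Ioo 0 L)] F)
    (hF' : IsPrim L F (dx v j.succ)) : endTrace L k j a v = F a := by
  have hG : IsPrim L (fun x => x - (L - a)) (fun _ => 1) := by
    refine (IsPrim.of_contDiff (by fun_prop)).congr_right (Eventually.of_forall fun x => ?_)
    simp
  have e := hF'.integral_mul_eq hL.le hG
  have e1 : inner ℝ (contL2 L (fun _ => 1) continuous_const) (dx v j.castSucc)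
      = ∫ x in Ioo 0 L, F x * 1 := by
    rw [real_inner_comm, ← ip_eq_inner]
    exact ip_congr hF (coeFn_contL2 _ _)
  have e2 : inner ℝ (contL2 L (fun x => x - (L - a)) (by fun_prop)) (dx v j.succ)
      = ∫ x in Ioo 0 L, dx v j.succ x * (x - (L - a)) := by
    rw [real_inner_comm, ← ip_eq_inner]
    exact ip_congr (ae_eq_refl _) (coeFn_contL2 _ _)
  simp only [endTrace, _root_.smul_apply, _root_.add_apply,
    ContinuousLinearMap.comp_apply, innerSL_apply_apply, dxL_apply, smul_eq_mul]
  rw [e1, e2, e]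
  rcases ha with rfl | rfl <;> field_simp <;> ring

/-- Continuous functions that agree a.e. agree on all of `[0,L]`, so the choice of representative is
immaterial. Boundary conditions thereby become kernels of continuous functionals, in particular
closed conditions that commute with time integrals. -/
theorem hasTrace_iff_endTrace (hL : 0 < L) (v : Sobolev L k) (j : Fin k) {a : ℝ}
    (ha : a = 0 ∨ a = L) (c : ℝ) :
    HasTrace L (dx v j.castSucc) a c ↔ endTrace L k j a v = c := by
  obtain ⟨F, hF, hF'⟩ := exists_isPrim_dx hL v j
  rw [endTrace_eq hL v j ha hF hF']
  constructor
  · rintro ⟨g, hg, hfg, rfl⟩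
    have h : F =ᵐ[volume.restrict (Icc 0 L)] g := by
      rw [← restrict_Ioo_eq_restrict_Icc]
      exact hF.symm.trans hfg
    refine Measure.eqOn_Icc_of_ae_eq volume hL.ne h (hF'.continuousOn hL.le) hg ?_
    rcases ha with rfl | rfl
    · exact left_mem_Icc.2 hL.le
    · exact right_mem_Icc.2 hL.le
  · rintro rfl
    exact ⟨F, hF'.continuousOn hL.le, hF, rfl⟩

theorem mem_clamped_iff (hL : 0 < L) (v : Sobolev L (k + 2)) :
    v ∈ Clamped L (k + 2) ↔ endTrace L (k + 2) 0 0 v = 0 ∧ endTrace L (k + 2) 1 0 v = 0 := by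
  rw [← hasTrace_iff_endTrace hL v 0 (Or.inl rfl), ← hasTrace_iff_endTrace hL v 1 (Or.inl rfl)]
  rfl

theorem freeEnd_iff (hL : 0 < L) (v : Sobolev L 4) :
    FreeEnd L v ↔ endTrace L 4 2 L v = 0 ∧ endTrace L 4 3 L v = 0 := by
  rw [← hasTrace_iff_endTrace hL v 2 (Or.inr rfl), ← hasTrace_iff_endTrace hL v 3 (Or.inr rfl)]
  rfl

theorem isClosed_clamped (hL : 0 < L) : IsClosed (Clamped L (k + 2)) := by
  simp only [show Clamped L (k + 2) = {v | endTrace L (k + 2) 0 0 v = 0 ∧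
    endTrace L (k + 2) 1 0 v = 0} from Set.ext (mem_clamped_iff hL), ofPred_and]
  exact (isClosed_eq (by fun_prop) continuous_const).inter
    (isClosed_eq (by fun_prop) continuous_const)

theorem isClosed_domA (hL : 0 < L) : IsClosed (DomA L) := by
  have : DomA L = Clamped L 4 ∩ {v | endTrace L 4 2 L v = 0 ∧ endTrace L 4 3 L v = 0} := by
    ext v
    exact and_congr_right fun _ => freeEnd_iff hL v
  rw [this, ofPred_and]
  exact (isClosed_clamped (k := 2) hL).inter ((isClosed_eq (by fun_prop) continuous_const).inter
    (isClosed_eq (by fun_prop) continuous_const))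

/-- Integrate twice from the clamped end. -/
theorem clamped_eq_zero (hL : 0 < L) {v : Sobolev L 2} (hv : v ∈ Clamped L 2)
    (h2 : dx v 2 = 0) : v = 0 := by
  have step : ∀ j : Fin 2, dx v j.succ = 0 → endTrace L 2 j 0 v = 0 → dx v j.castSucc = 0 := by
    intro j h0 ht
    obtain ⟨F, hF, hF'⟩ := exists_isPrim_dx hL v j
    rw [endTrace_eq hL v j (Or.inl rfl) hF hF'] at ht
    have h0' : dx v j.succ =ᵐ[volume.restrict (Ioo 0 L)] 0 := by
      rw [h0]
      exact Lp.coeFn_zero _ _ _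
    have hc : ∀ x ∈ Ioo 0 L, F x = 0 := by
      intro x hx
      have hs : uIcc 0 x ⊆ uIcc 0 L := by
        rw [uIcc_of_le hx.1.le, uIcc_of_le hL.le]
        exact Icc_subset_Icc_right hx.2.le
      have hp : IsPrim x F (dx v j.succ) := ⟨hF'.ac.mono hs,
        ae_restrict_of_ae_restrict_of_subset (Ioo_subset_Ioo_right hx.2.le) hF'.hasDerivAt⟩
      have := hp.integral_eq hx.1.le
      rw [integral_congr_ae (ae_restrict_of_ae_restrict_of_subset
        (Ioo_subset_Ioo_right hx.2.le) h0'), ht] at this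
      simpa using this.symm
    refine Lp.ext ((hF.trans ?_).trans (Lp.coeFn_zero _ _ _).symm)
    exact ae_restrict_of_forall_mem measurableSet_Ioo hc
  obtain ⟨t0, t1⟩ := (mem_clamped_iff (k := 0) hL v).1 hv
  have h1 : dx v 1 = 0 := step 1 h2 t1
  have h0 : dx v 0 = 0 := step 0 h1 t0
  exact dx_zero_injective h0

/-! ### Products with bounded functions -/

/-- The embedding of `H¹` into `L^∞`: `|F(x)| ≤ |F(0)| + ∫ |F'|`, with the trace bounded by its
operator norm and the integral by Cauchy–Schwarz against `1`. -/
theorem exists_bound_dx (hL : 0 < L) (j : Fin k) : ∃ C : ℝ, ∀ v : Sobolev L k,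
    ∀ᵐ x ∂(volume.restrict (Ioo 0 L)), ‖dx v j.castSucc x‖ ≤ C * ‖v‖ := by
  set one := contL2 L (fun _ => 1) continuous_const
  refine ⟨‖endTrace L k j 0‖ + ‖dxL L k j.succ‖ * ‖one‖, fun v => ?_⟩
  obtain ⟨F, hF, hF'⟩ := exists_isPrim_dx hL v j
  have h0 := endTrace_eq hL v j (Or.inl rfl) hF hF'
  have hg : ∫ x in Ioo 0 L, ‖dx v j.succ x‖ ≤ ‖dxL L k j.succ‖ * ‖one‖ * ‖v‖ := by
    have : ∫ x in Ioo 0 L, ‖dx v j.succ x‖ = inner ℝ |dx v j.succ| one := by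
      rw [← ip_eq_inner, ip_congr (Lp.coeFn_abs _) (coeFn_contL2 _ _)]
      simp [ip]
    rw [this]
    calc inner ℝ |dx v j.succ| one ≤ ‖|dx v j.succ|‖ * ‖one‖ := real_inner_le_norm _ _
      _ = ‖dxL L k j.succ v‖ * ‖one‖ := by rw [norm_abs_eq_norm, dxL_apply]
      _ ≤ ‖dxL L k j.succ‖ * ‖v‖ * ‖one‖ := by
        gcongr
        exact ContinuousLinearMap.le_opNorm _ _
      _ = _ := by ring
  filter_upwards [hF, ae_restrict_mem measurableSet_Ioo] with x hx hx'
  have hs : uIcc 0 x ⊆ uIcc 0 L := by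
    rw [uIcc_of_le hx'.1.le, uIcc_of_le hL.le]
    exact Icc_subset_Icc_right hx'.2.le
  have hp : IsPrim x F (dx v j.succ) := ⟨hF'.ac.mono hs,
    ae_restrict_of_ae_restrict_of_subset (Ioo_subset_Ioo_right hx'.2.le) hF'.hasDerivAt⟩
  have e := hp.integral_eq hx'.1.le
  have h1 : ‖∫ y in Ioo 0 x, dx v j.succ y‖ ≤ ∫ y in Ioo 0 L, ‖dx v j.succ y‖ :=
    (norm_integral_le_integral_norm _).trans
      (setIntegral_mono_set (L2.integrableOn _).norm (Eventually.of_forall fun _ => norm_nonneg _)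
        (Ioo_subset_Ioo_right hx'.2.le).eventuallyLE)
  have h2 : ‖F 0‖ ≤ ‖endTrace L k j 0‖ * ‖v‖ := by
    rw [← h0]
    exact ContinuousLinearMap.le_opNorm _ _
  rw [hx, show F x = F 0 + ∫ y in Ioo 0 x, dx v j.succ y by rw [e]; ring, add_mul]
  exact (norm_add_le _ _).trans (add_le_add h2 (h1.trans hg))

theorem memLp_top_dx (hL : 0 < L) (j : Fin k) (v : Sobolev L k) :
    MemLp (dx v j.castSucc) ⊤ (volume.restrict (Ioo 0 L)) := by
  obtain ⟨C, hC⟩ := exists_bound_dx (k := k) hL j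
  exact memLp_top_of_bound (Lp.aestronglyMeasurable _) _ (hC v)

/-- Hölder's inequality `L^∞ × L² → L²`. The cubic terms become compositions of such maps, so they
are continuous in `w`, and therefore measurable in time, without separate estimates. -/
theorem exists_mulL (hL : 0 < L) (j : Fin k) : ∃ B : Sobolev L k →L[ℝ] L2 L →L[ℝ] L2 L,
    ∀ v h, B v h =ᵐ[volume.restrict (Ioo 0 L)] fun x => dx v j.castSucc x * h x := by
  obtain ⟨C, hC⟩ := exists_bound_dx (k := k) hL j
  let e : Sobolev L k →ₗ[ℝ] Lp ℝ ⊤ (volume.restrict (Ioo 0 L)) :=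
    { toFun := fun v => (memLp_top_dx hL j v).toLp _
      map_add' := fun v w => by
        refine Lp.ext ?_
        filter_upwards [MemLp.coeFn_toLp (memLp_top_dx hL j (v + w)),
          MemLp.coeFn_toLp (memLp_top_dx hL j v), MemLp.coeFn_toLp (memLp_top_dx hL j w),
          Lp.coeFn_add ((memLp_top_dx hL j v).toLp _) ((memLp_top_dx hL j w).toLp _),
          Lp.coeFn_add (dx v j.castSucc) (dx w j.castSucc)] with x h1 h2 h3 h4 h5
        rw [h1, h4, Pi.add_apply, h2, h3, dx_add, h5, Pi.add_apply]
      map_smul' := fun c v => by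
        refine Lp.ext ?_
        filter_upwards [MemLp.coeFn_toLp (memLp_top_dx hL j (c • v)),
          MemLp.coeFn_toLp (memLp_top_dx hL j v),
          Lp.coeFn_smul c ((memLp_top_dx hL j v).toLp _),
          Lp.coeFn_smul c (dx v j.castSucc)] with x h1 h2 h3 h4
        rw [h1, RingHom.id_apply, h3, Pi.smul_apply, h2]
        exact h4 }
  have he : ∀ v, ‖e v‖ ≤ max C 0 * ‖v‖ := by
    intro v
    have hb : ∀ᵐ x ∂(volume.restrict (Ioo 0 L)), ‖e v x‖ ≤ max C 0 * ‖v‖ := by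
      filter_upwards [hC v, MemLp.coeFn_toLp (memLp_top_dx hL j v)] with x h1 h2
      rw [show e v x = dx v j.castSucc x from h2]
      exact h1.trans (by gcongr; exact le_max_left _ _)
    have := Lp.norm_le_of_ae_bound (by positivity) hb
    simpa using this
  refine ⟨((ContinuousLinearMap.mul ℝ ℝ).holderL (volume.restrict (Ioo 0 L)) ⊤ 2 2).comp
    (e.mkContinuous _ he), fun v h => ?_⟩
  filter_upwards [ContinuousLinearMap.coeFn_holder (r := 2) (ContinuousLinearMap.mul ℝ ℝ) (e v) h,
    MemLp.coeFn_toLp (memLp_top_dx hL j v)] with x h1 h2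
  rw [← h2]
  exact h1

/-! ### Smooth elements -/

theorem isWeakDeriv_iteratedDeriv (hL : 0 ≤ L) {φ : ℝ → ℝ} (hφ : ContDiff ℝ ∞ φ) (j : ℕ) :
    IsWeakDeriv L j φ (iteratedDeriv j φ) := by
  have hs : ∀ i, ContDiff ℝ ∞ (iteratedDeriv i φ) := fun i => by
    rw [iteratedDeriv_eq_iterate]
    exact hφ.iterate_deriv i
  induction j with
  | zero =>
    have := ((IsPrim.of_contDiff hφ).integrableOn hL)
    refine ⟨this, by simpa using this, fun ψ _ => by simp⟩
  | succ j ih =>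
    refine ih.trans ?_
    rw [iteratedDeriv_succ]
    exact (IsPrim.of_contDiff (hs j)).isWeakDeriv hL

theorem exists_sobolev_of_contDiff (hL : 0 ≤ L) (k : ℕ) {φ : ℝ → ℝ} (hφ : ContDiff ℝ ∞ φ) :
    ∃ v : Sobolev L k, ∀ j, dx v j =ᵐ[volume.restrict (Ioo 0 L)] iteratedDeriv j φ := by
  have hc : ∀ i : ℕ, Continuous (iteratedDeriv i φ) := fun i =>
    hφ.continuous_iteratedDeriv i (by exact_mod_cast le_top)
  refine ⟨⟨WithLp.toLp 2 fun j => contL2 L _ (hc j), fun j => ?_⟩, fun j => coeFn_contL2 _ (hc j)⟩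
  have := isWeakDeriv_iteratedDeriv hL hφ j
  refine this.congr ?_ (coeFn_contL2 _ (hc j))
  have := coeFn_contL2 (L := L) _ (hc 0)
  exact this.trans (by rw [iteratedDeriv_zero])

theorem exists_clamped_of_contDiff (hL : 0 ≤ L) {φ : ℝ → ℝ} (hφ : ContDiff ℝ ∞ φ)
    (h0 : φ 0 = 0) (h1 : deriv φ 0 = 0) :
    ∃ v ∈ Clamped L 2, dx v 0 =ᵐ[volume.restrict (Ioo 0 L)] φ ∧
      dx v 1 =ᵐ[volume.restrict (Ioo 0 L)] deriv φ ∧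
      dx v 2 =ᵐ[volume.restrict (Ioo 0 L)] deriv (deriv φ) := by
  obtain ⟨v, hv⟩ := exists_sobolev_of_contDiff hL 2 hφ
  have e0 := hv 0
  have e1 := hv 1
  have e2 := hv 2
  simp only [Fin.val_zero, Fin.val_one, Fin.val_two, iteratedDeriv_zero,
    iteratedDeriv_succ] at e0 e1 e2
  exact ⟨v, ⟨⟨φ, hφ.continuous.continuousOn, e0, h0⟩,
    ⟨_, ((contDiff_infty_iff_deriv.1 hφ).2).continuous.continuousOn, e1, h1⟩⟩, e0, e1, e2⟩

/-! ### The stationary problem at a fixed time -/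

theorem IsPrim.ae_eq_left {F f G : ℝ → ℝ} (hL : 0 < L) (hF : IsPrim L F f)
    (hG : ContinuousOn G (Icc 0 L)) (h : F =ᵐ[volume.restrict (Ioo 0 L)] G) :
    EqOn F G (Icc 0 L) := by
  rw [restrict_Ioo_eq_restrict_Icc] at h
  exact Measure.eqOn_Icc_of_ae_eq volume hL.ne h (hF.continuousOn hL.le) hG

/-- Only continuity is recorded, since the derivative will be read off from the equation. The value
at `L` vanishes because the integral from `x` to `L` is empty there. -/
theorem inertiaFlux_rep (hL : 0 < L) (w wt : Sobolev L 4) (wtt : Sobolev L 2) :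
    ∃ F : ℝ → ℝ, ContinuousOn F (Icc 0 L) ∧
      inertiaFlux w wt wtt =ᵐ[volume.restrict (Ioo 0 L)] F ∧ F L = 0 := by
  obtain ⟨W, hW, hW'⟩ := exists_isPrim_dx hL w 1
  have hint : IntegrableOn (fun ξ => (dx wt 1 ξ) ^ 2 + dx w 1 ξ * dx wtt 1 ξ) (Ioo 0 L) :=
    Integrable.add (Lp.memLp _).integrable_sq ((Lp.memLp _).integrable_mul (Lp.memLp _))
  have hA : ContinuousOn (axialAcc w wt wtt) (Icc 0 L) := (continuousOn_integral hL.le hint).neg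
  have hAi : IntegrableOn (axialAcc w wt wtt) (Ioo 0 L) :=
    hA.integrableOn_Icc.mono_set Ioo_subset_Icc_self
  have hAI : ContinuousOn (fun x => ∫ ξ in x..L, axialAcc w wt wtt ξ) (Icc 0 L) := by
    have h1 := (continuousOn_const (c := ∫ ξ in (0 : ℝ)..L, axialAcc w wt wtt ξ)).sub
      (continuousOn_integral hL.le hAi)
    refine h1.congr fun x hx => ?_
    have i1 : IntervalIntegrable (axialAcc w wt wtt) volume 0 x :=
      (hA.mono (by rw [uIcc_of_le hx.1]; exact Icc_subset_Icc_right hx.2)).intervalIntegrable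
    have i2 : IntervalIntegrable (axialAcc w wt wtt) volume x L :=
      (hA.mono (by rw [uIcc_of_le hx.2]; exact Icc_subset_Icc_left hx.1)).intervalIntegrable
    rw [Pi.sub_apply, ← intervalIntegral.integral_add_adjacent_intervals i1 i2,
      add_sub_cancel_left]
  refine ⟨fun x => W x * ∫ ξ in x..L, axialAcc w wt wtt ξ, (hW'.continuousOn hL.le).mul hAI,
    ?_, by simp⟩
  filter_upwards [hW] with x hx
  exact congrArg (· * _) hx

/-- The weak form is a continuous linear equation for the test function. -/
theorem isClosed_weakForm (hL : 0 < L) (D k₂ : ℝ) (p : L2 L) (w wt : Sobolev L 4)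
    (wtt : Sobolev L 2) : IsClosed {φ | WeakForm D k₂ p w wt wtt φ} := by
  obtain ⟨B₁, hB₁⟩ := exists_mulL (k := 4) hL 1
  obtain ⟨B₂, hB₂⟩ := exists_mulL (k := 4) hL 2
  obtain ⟨F, hFc, hF, -⟩ := inertiaFlux_rep hL w wt wtt
  have hFm := memLp_of_continuousOn hFc 2
  have e1 : ∀ φ : Sobolev L 2, ip L (fun x => dx w 2 x * dx w 1 x) (fun x => dx w 1 x * dx φ 2 x)
      = inner ℝ (B₁ w (B₁ w (dx w 2))) (dx φ 2) := by
    intro φ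
    rw [← ip_eq_inner]
    refine integral_congr_ae ?_
    filter_upwards [hB₁ w (B₁ w (dx w 2)), hB₁ w (dx w 2)] with x h1 h2
    rw [h1, h2]
    change _ = dx w 1 x * (dx w 1 x * _) * _
    ring
  have e2 : ∀ φ : Sobolev L 2, ip L (fun x => dx w 2 x * dx w 1 x) (fun x => dx w 2 x * dx φ 1 x)
      = inner ℝ (B₂ w (B₁ w (dx w 2))) (dx φ 1) := by
    intro φ
    rw [← ip_eq_inner]
    refine integral_congr_ae ?_
    filter_upwards [hB₂ w (B₁ w (dx w 2)), hB₁ w (dx w 2)] with x h1 h2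
    rw [h1, h2]
    change _ = dx w 2 x * (dx w 1 x * _) * _
    ring
  have e3 : ∀ φ : Sobolev L 2, ip L (inertiaFlux w wt wtt) (dx φ 1)
      = inner ℝ (hFm.toLp F) (dx φ 1) := by
    intro φ
    rw [← ip_eq_inner]
    exact ip_congr (hF.trans hFm.coeFn_toLp.symm) (ae_eq_refl _)
  have hc : ∀ j, Continuous fun φ : Sobolev L 2 => dx φ j := fun j => (dxL L 2 j).continuous
  simp only [WeakForm, e1, e2, e3, ip_eq_inner]
  exact isClosed_eq (by fun_prop) (by fun_prop)

/-- The spatial derivative `∂ₓ[w_xx² w_x]` depends continuously on `w ∈ H⁴`. -/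
theorem exists_cubic₁ (hL : 0 < L) : ∃ S : Sobolev L 4 → L2 L, Continuous S ∧
    ∀ v, S v =ᵐ[volume.restrict (Ioo 0 L)]
      fun x => 2 * dx v 1 x * dx v 2 x * dx v 3 x + dx v 2 x ^ 3 := by
  obtain ⟨B₁, hB₁⟩ := exists_mulL (k := 4) hL 1
  obtain ⟨B₂, hB₂⟩ := exists_mulL (k := 4) hL 2
  have hc : ∀ j, Continuous fun φ : Sobolev L 4 => dx φ j := fun j => (dxL L 4 j).continuous
  refine ⟨fun v => (2 : ℝ) • B₁ v (B₂ v (dx v 3)) + B₂ v (B₂ v (dx v 2)), by fun_prop,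
    fun v => ?_⟩
  filter_upwards [hB₁ v (B₂ v (dx v 3)), hB₂ v (B₂ v (dx v 2)), hB₂ v (dx v 3), hB₂ v (dx v 2),
    Lp.coeFn_add ((2 : ℝ) • B₁ v (B₂ v (dx v 3))) (B₂ v (B₂ v (dx v 2))),
    Lp.coeFn_smul (2 : ℝ) (B₁ v (B₂ v (dx v 3)))] with x h1 h2 h3 h4 h5 h6
  rw [h5, Pi.add_apply, h6, Pi.smul_apply, h1, h2, h3, h4, smul_eq_mul]
  change 2 * (dx v 1 x * (dx v 2 x * _)) + dx v 2 x * (dx v 2 x * _) = _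
  ring

/-- The spatial derivative `∂ₓₓ[w_xx w_x²]` depends continuously on `w ∈ H⁴`. -/
theorem exists_cubic₂ (hL : 0 < L) : ∃ S : Sobolev L 4 → L2 L, Continuous S ∧
    ∀ v, S v =ᵐ[volume.restrict (Ioo 0 L)]
      fun x => dx v 1 x ^ 2 * dx v 4 x + 6 * dx v 1 x * dx v 2 x * dx v 3 x
        + 2 * dx v 2 x ^ 3 := by
  obtain ⟨B₁, hB₁⟩ := exists_mulL (k := 4) hL 1
  obtain ⟨B₂, hB₂⟩ := exists_mulL (k := 4) hL 2
  have hc : ∀ j, Continuous fun φ : Sobolev L 4 => dx φ j := fun j => (dxL L 4 j).continuous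
  refine ⟨fun v => B₁ v (B₁ v (dx v 4)) + (6 : ℝ) • B₁ v (B₂ v (dx v 3))
    + (2 : ℝ) • B₂ v (B₂ v (dx v 2)), by fun_prop, fun v => ?_⟩
  filter_upwards [hB₁ v (B₂ v (dx v 3)), hB₂ v (B₂ v (dx v 2)), hB₂ v (dx v 3), hB₂ v (dx v 2),
    hB₁ v (B₁ v (dx v 4)), hB₁ v (dx v 4),
    Lp.coeFn_add (B₁ v (B₁ v (dx v 4)) + (6 : ℝ) • B₁ v (B₂ v (dx v 3)))
      ((2 : ℝ) • B₂ v (B₂ v (dx v 2))),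
    Lp.coeFn_add (B₁ v (B₁ v (dx v 4))) ((6 : ℝ) • B₁ v (B₂ v (dx v 3))),
    Lp.coeFn_smul (6 : ℝ) (B₁ v (B₂ v (dx v 3))),
    Lp.coeFn_smul (2 : ℝ) (B₂ v (B₂ v (dx v 2)))] with x h1 h2 h3 h4 h5 h6 h7 h8 h9 h10
  rw [h7, Pi.add_apply, h8, Pi.add_apply, h9, h10, Pi.smul_apply, Pi.smul_apply, h1, h2, h3, h4,
    h5, h6, smul_eq_mul, smul_eq_mul]
  change dx v 1 x * (dx v 1 x * _) + 6 * (dx v 1 x * (dx v 2 x * _))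
    + 2 * (dx v 2 x * (dx v 2 x * _)) = _
  ring

/-- The derivatives of orders one to three of an element of `H⁴` as absolutely continuous
functions. -/
theorem exists_reps (hL : 0 < L) (w : Sobolev L 4) : ∃ W₁ W₂ W₃ : ℝ → ℝ,
    (dx w 1 =ᵐ[volume.restrict (Ioo 0 L)] W₁ ∧ dx w 2 =ᵐ[volume.restrict (Ioo 0 L)] W₂ ∧
      dx w 3 =ᵐ[volume.restrict (Ioo 0 L)] W₃) ∧
    (IsPrim L W₁ W₂ ∧ IsPrim L W₂ W₃ ∧ IsPrim L W₃ (dx w 4)) ∧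
    (endTrace L 4 1 L w = W₁ L ∧ endTrace L 4 2 L w = W₂ L ∧ endTrace L 4 3 L w = W₃ L) := by
  obtain ⟨W₁, h1, h1'⟩ := exists_isPrim_dx hL w 1
  obtain ⟨W₂, h2, h2'⟩ := exists_isPrim_dx hL w 2
  obtain ⟨W₃, h3, h3'⟩ := exists_isPrim_dx hL w 3
  exact ⟨W₁, W₂, W₃, ⟨h1, h2, h3⟩, ⟨h1'.congr_right h2.symm, h2'.congr_right h3.symm, h3'⟩,
    endTrace_eq hL w 1 (Or.inr rfl) h1 h1', endTrace_eq hL w 2 (Or.inr rfl) h2 h2',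
    endTrace_eq hL w 3 (Or.inr rfl) h3 h3'⟩

theorem IsPrim.cubic₁ {W₁ W₂ W₃ : ℝ → ℝ} (h1 : IsPrim L W₁ W₂) (h2 : IsPrim L W₂ W₃) :
    IsPrim L (fun x => W₂ x ^ 2 * W₁ x) (fun x => 2 * W₁ x * W₂ x * W₃ x + W₂ x ^ 3) := by
  have := (h2.mul h2).mul h1
  simp only [← sq] at this
  exact this.congr_right (Eventually.of_forall fun x => by ring)

/-- The derivative is grouped so that `W₂² W₁` appears, which lets `cubic₁` supply the next
derivative. -/
theorem IsPrim.cubic₂ {W₁ W₂ W₃ : ℝ → ℝ} (h1 : IsPrim L W₁ W₂) (h2 : IsPrim L W₂ W₃) :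
    IsPrim L (fun x => W₂ x * W₁ x ^ 2) (fun x => W₃ x * W₁ x ^ 2 + 2 * (W₂ x ^ 2 * W₁ x)) := by
  have := h2.mul (h1.mul h1)
  simp only [← sq] at this
  exact this.congr_right (Eventually.of_forall fun x => by ring)

theorem IsPrim.cubic₂_deriv {W₁ W₂ W₃ W₄ : ℝ → ℝ} (h1 : IsPrim L W₁ W₂) (h2 : IsPrim L W₂ W₃)
    (h3 : IsPrim L W₃ W₄) :
    IsPrim L (fun x => W₃ x * W₁ x ^ 2 + 2 * (W₂ x ^ 2 * W₁ x))
      (fun x => W₁ x ^ 2 * W₄ x + 6 * W₁ x * W₂ x * W₃ x + 2 * W₂ x ^ 3) := by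
  have := (h3.mul (h1.mul h1)).add ((h1.cubic₁ h2).const_mul 2)
  simp only [← sq] at this
  exact this.congr_right (Eventually.of_forall fun x => by ring)

theorem isWeakDeriv_cubic₁ (hL : 0 < L) (w : Sobolev L 4) {S : ℝ → ℝ}
    (hS : S =ᵐ[volume.restrict (Ioo 0 L)]
      fun x => 2 * dx w 1 x * dx w 2 x * dx w 3 x + dx w 2 x ^ 3) :
    IsWeakDeriv L 1 (fun x => dx w 2 x ^ 2 * dx w 1 x) S := by
  obtain ⟨W₁, W₂, W₃, ⟨e1, e2, e3⟩, ⟨h1, h2, h3⟩, -⟩ := exists_reps hL w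
  refine ((h1.cubic₁ h2).isWeakDeriv hL.le).congr ?_ ?_
  · filter_upwards [e1, e2] with x a1 a2
    rw [a1, a2]
  · filter_upwards [hS, e1, e2, e3] with x a0 a1 a2 a3
    rw [a0, a1, a2, a3]

theorem isWeakDeriv_cubic₂ (hL : 0 < L) (w : Sobolev L 4) {S : ℝ → ℝ}
    (hS : S =ᵐ[volume.restrict (Ioo 0 L)]
      fun x => dx w 1 x ^ 2 * dx w 4 x + 6 * dx w 1 x * dx w 2 x * dx w 3 x
        + 2 * dx w 2 x ^ 3) :
    IsWeakDeriv L 2 (fun x => dx w 2 x * dx w 1 x ^ 2) S := by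
  obtain ⟨W₁, W₂, W₃, ⟨e1, e2, e3⟩, ⟨h1, h2, h3⟩, -⟩ := exists_reps hL w
  refine (((h1.cubic₂ h2).isWeakDeriv hL.le).trans
    ((h1.cubic₂_deriv h2 h3).isWeakDeriv hL.le)).congr ?_ ?_
  · filter_upwards [e1, e2] with x a1 a2
    rw [a1, a2]
  · filter_upwards [hS, e1, e2, e3] with x a0 a1 a2 a3
    rw [a0, a1, a2, a3]

theorem IsPrim.integral_mul_deriv_deriv (hL : 0 ≤ L) {M M₁ m φ : ℝ → ℝ} (h : IsPrim L M M₁)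
    (h' : IsPrim L M₁ m) (hφ : ContDiff ℝ ∞ φ) (h0 : φ 0 = 0) (h1 : deriv φ 0 = 0) :
    ∫ x in Ioo 0 L, M x * deriv (deriv φ) x
      = M L * deriv φ L - M₁ L * φ L + ∫ x in Ioo 0 L, m x * φ x := by
  rw [h.integral_mul_eq hL (of_contDiff (contDiff_infty_iff_deriv.1 hφ).2),
    h'.integral_mul_eq hL (of_contDiff hφ), h0, h1]
  ring

/-- The heart of the argument: one integration-by-parts identity, `key`, contains both the equation
in the interior and the natural boundary conditions at `L`. -/
theorem stationary (hL : 0 < L) {D k₂ : ℝ} {p : L2 L} {w wt : Sobolev L 4} {wtt : Sobolev L 2}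
    {S₁ S₂ N : L2 L}
    (hS₁ : S₁ =ᵐ[volume.restrict (Ioo 0 L)]
      fun x => 2 * dx w 1 x * dx w 2 x * dx w 3 x + dx w 2 x ^ 3)
    (hS₂ : S₂ =ᵐ[volume.restrict (Ioo 0 L)]
      fun x => dx w 1 x ^ 2 * dx w 4 x + 6 * dx w 1 x * dx w 2 x * dx w 3 x
        + 2 * dx w 2 x ^ 3)
    (hN : N = p - dx wtt 0 - D • dx w 4 - k₂ • dx wt 4 + D • S₁ - D • S₂)
    (hweak : ∀ φ ∈ Clamped L 2, WeakForm D k₂ p w wt wtt φ) :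
    IsWeakDeriv L 1 (inertiaFlux w wt wtt) N ∧
    k₂ * endTrace L 4 2 L wt
      = -(D * (1 + endTrace L 4 1 L w ^ 2)) * endTrace L 4 2 L w ∧
    k₂ * endTrace L 4 3 L wt
      = -(D * (1 + endTrace L 4 1 L w ^ 2)) * endTrace L 4 3 L w
        - D * endTrace L 4 2 L w ^ 2 * endTrace L 4 1 L w := by
  obtain ⟨W₁, W₂, W₃, ⟨e1, e2, e3⟩, ⟨h1, h2, h3⟩, ⟨t1, t2, t3⟩⟩ := exists_reps hL w
  obtain ⟨V₁, V₂, V₃, ⟨-, f2, -⟩, ⟨-, g2, g3⟩, ⟨-, s2, s3⟩⟩ := exists_reps hL wt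
  obtain ⟨F, hFc, hF, hFL⟩ := inertiaFlux_rep hL w wt wtt
  have hM := ((h2.const_mul D).add (g2.const_mul k₂)).add ((h1.cubic₂ h2).const_mul D)
  have hM₁ := ((h3.const_mul D).add (g3.const_mul k₂)).add ((h1.cubic₂_deriv h2 h3).const_mul D)
  have hQ := (h1.cubic₁ h2).const_mul D
  -- `M` multiplies `φ''` in the weak form and `Q` multiplies `φ'`; `M₁` and `m` are the first two
  -- derivatives of `M`, and `q` is that of `Q`.
  set M : ℝ → ℝ := fun x => D * W₂ x + k₂ * V₂ x + D * (W₂ x * W₁ x ^ 2) with hMdef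
  set M₁ : ℝ → ℝ := fun x => D * W₃ x + k₂ * V₃ x
    + D * (W₃ x * W₁ x ^ 2 + 2 * (W₂ x ^ 2 * W₁ x)) with hM₁def
  set m : ℝ → ℝ := fun x => D * dx w 4 x + k₂ * dx wt 4 x
    + D * (W₁ x ^ 2 * dx w 4 x + 6 * W₁ x * W₂ x * W₃ x + 2 * W₂ x ^ 3) with hm
  set Q : ℝ → ℝ := fun x => D * (W₂ x ^ 2 * W₁ x) with hQdef
  set q : ℝ → ℝ := fun x => D * (2 * W₁ x * W₂ x * W₃ x + W₂ x ^ 3) with hq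
  have hNae : N =ᵐ[volume.restrict (Ioo 0 L)] fun x => p x - dx wtt 0 x - m x + q x := by
    rw [hN]
    filter_upwards [hS₁, hS₂, e1, e2, e3,
      Lp.coeFn_sub (p - dx wtt 0 - D • dx w 4 - k₂ • dx wt 4 + D • S₁) (D • S₂),
      Lp.coeFn_add (p - dx wtt 0 - D • dx w 4 - k₂ • dx wt 4) (D • S₁),
      Lp.coeFn_sub (p - dx wtt 0 - D • dx w 4) (k₂ • dx wt 4),
      Lp.coeFn_sub (p - dx wtt 0) (D • dx w 4), Lp.coeFn_sub p (dx wtt 0),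
      Lp.coeFn_smul D S₂, Lp.coeFn_smul D S₁, Lp.coeFn_smul k₂ (dx wt 4),
      Lp.coeFn_smul D (dx w 4)] with x b1 b2 b3 b4 b5 d1 d2 d3 d4 d5 d6 d7 d8 d9
    rw [d1, Pi.sub_apply, d2, Pi.add_apply, d3, Pi.sub_apply, d4, Pi.sub_apply, d5, Pi.sub_apply,
      d6, d7, d8, d9]
    simp only [Pi.smul_apply, smul_eq_mul, hm, hq, b1, b2, b3, b4, b5]
    ring
  have key : ∀ φ : ℝ → ℝ, ContDiff ℝ ∞ φ → φ 0 = 0 → deriv φ 0 = 0 →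
      ∫ x in Ioo 0 L, F x * deriv φ x
        = M L * deriv φ L + (Q L - M₁ L) * φ L - ∫ x in Ioo 0 L, N x * φ x := by
    intro φ hφ h0 h0'
    have hφ' := (contDiff_infty_iff_deriv.1 hφ).2
    have hφ'' := (contDiff_infty_iff_deriv.1 hφ').2
    have hmul : ∀ {f g : ℝ → ℝ}, IntegrableOn f (Ioo 0 L) → Continuous g →
        IntegrableOn (fun x => f x * g x) (Ioo 0 L) := fun hf hg =>
      hf.mul_continuousOn_of_subset hg.continuousOn measurableSet_Ioo isCompact_Icc
        Ioo_subset_Icc_self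
    obtain ⟨v, hv, v0, v1, v2⟩ := exists_clamped_of_contDiff hL.le hφ h0 h0'
    have hw := hweak v hv
    have a1 : ip L (dx wtt 0) (dx v 0) = ∫ x in Ioo 0 L, dx wtt 0 x * φ x :=
      ip_congr (ae_eq_refl _) v0
    have a2 : ip L (dx w 2) (dx v 2) = ∫ x in Ioo 0 L, W₂ x * deriv (deriv φ) x := ip_congr e2 v2
    have a3 : ip L (dx wt 2) (dx v 2) = ∫ x in Ioo 0 L, V₂ x * deriv (deriv φ) x := ip_congr f2 v2
    have a4 : ip L (fun x => dx w 2 x * dx w 1 x) (fun x => dx w 1 x * dx v 2 x)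
        = ∫ x in Ioo 0 L, (W₂ x * W₁ x ^ 2) * deriv (deriv φ) x := by
      refine integral_congr_ae ?_
      filter_upwards [e1, e2, v2] with x b1 b2 b3
      rw [b1, b2, b3]
      ring
    have a5 : ip L (fun x => dx w 2 x * dx w 1 x) (fun x => dx w 2 x * dx v 1 x)
        = ∫ x in Ioo 0 L, (W₂ x ^ 2 * W₁ x) * deriv φ x := by
      refine integral_congr_ae ?_
      filter_upwards [e1, e2, v1] with x b1 b2 b3
      rw [b1, b2, b3]
      ring
    have a6 : ip L (inertiaFlux w wt wtt) (dx v 1) = ∫ x in Ioo 0 L, F x * deriv φ x :=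
      ip_congr hF v1
    have a7 : ip L p (dx v 0) = ∫ x in Ioo 0 L, p x * φ x := ip_congr (ae_eq_refl _) v0
    have b1 : ∫ x in Ioo 0 L, M x * deriv (deriv φ) x
        = D * (∫ x in Ioo 0 L, W₂ x * deriv (deriv φ) x)
          + k₂ * (∫ x in Ioo 0 L, V₂ x * deriv (deriv φ) x)
          + D * ∫ x in Ioo 0 L, (W₂ x * W₁ x ^ 2) * deriv (deriv φ) x := by
      have c1 := (hmul (h2.integrableOn hL.le) hφ''.continuous).const_mul D
      have c2 := (hmul (g2.integrableOn hL.le) hφ''.continuous).const_mul k₂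
      have c3 := (hmul ((h1.cubic₂ h2).integrableOn hL.le) hφ''.continuous).const_mul D
      rw [← integral_const_mul, ← integral_const_mul, ← integral_const_mul, ← integral_add' c1 c2,
        ← integral_add' (c1.add c2) c3]
      simp only [hMdef, Pi.add_apply, add_mul, mul_assoc]
    have b2 : ∫ x in Ioo 0 L, Q x * deriv φ x
        = D * ∫ x in Ioo 0 L, (W₂ x ^ 2 * W₁ x) * deriv φ x := by
      rw [← integral_const_mul]
      simp only [hQdef, mul_assoc]
    have b3 := hM.integral_mul_deriv_deriv hL.le hM₁ hφ h0 h0'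
    have b4 := hQ.integral_mul_eq hL.le (IsPrim.of_contDiff hφ)
    have b5 : ∫ x in Ioo 0 L, N x * φ x = (∫ x in Ioo 0 L, p x * φ x)
        - (∫ x in Ioo 0 L, dx wtt 0 x * φ x) - (∫ x in Ioo 0 L, m x * φ x)
        + ∫ x in Ioo 0 L, q x * φ x := by
      have c1 := hmul (L2.integrableOn p) hφ.continuous
      have c2 := hmul (L2.integrableOn (dx wtt 0)) hφ.continuous
      have c3 := hmul (hM₁.integrableOn_deriv hL.le) hφ.continuous
      have c4 := hmul (hQ.integrableOn_deriv hL.le) hφ.continuous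
      rw [← integral_sub' c1 c2, ← integral_sub' (c1.sub c2) c3,
        ← integral_add' ((c1.sub c2).sub c3) c4]
      refine integral_congr_ae ?_
      filter_upwards [hNae] with x hx
      simp only [hx, Pi.sub_apply, Pi.add_apply]
      ring
    rw [WeakForm, a1, a2, a3, a4, a5, a6, a7] at hw
    rw [h0] at b4
    linarith
  have hFN : IsWeakDeriv L 1 F N := by
    refine ⟨hFc.integrableOn_Icc.mono_set Ioo_subset_Icc_self, L2.integrableOn N, fun φ hφ => ?_⟩
    rw [iteratedDeriv_one, key φ hφ.1 (hφ.eq_zero (by simp)) (hφ.derivative.eq_zero (by simp)),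
      hφ.eq_zero (x := L) (by simp), hφ.derivative.eq_zero (x := L) (by simp)]
    ring
  -- Having a weak derivative, `F` is absolutely continuous, so `∫ F φ'` may be integrated by parts
  -- for `φ` not vanishing at `L`; the new boundary term is zero because `F(L) = 0`.
  obtain ⟨G, hG, hG'⟩ := hFN.exists_isPrim hL
  have hGL : G L = 0 := by
    rw [hG'.ae_eq_left hL hFc hG.symm (right_mem_Icc.2 hL.le), hFL]
  have bc : ∀ φ : ℝ → ℝ, ContDiff ℝ ∞ φ → φ 0 = 0 → deriv φ 0 = 0 →
      M L * deriv φ L + (Q L - M₁ L) * φ L = 0 := by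
    intro φ hφ h0 h0'
    have c1 := key φ hφ h0 h0'
    have c2 := hG'.integral_mul_eq hL.le (IsPrim.of_contDiff hφ)
    have c3 : ∫ x in Ioo 0 L, F x * deriv φ x = ∫ x in Ioo 0 L, G x * deriv φ x :=
      ip_congr hG (ae_eq_refl _)
    rw [hGL, h0] at c2
    linarith
  have d1 : deriv (fun x : ℝ => x ^ 2) = fun x => 2 * x := by
    funext x
    simp
  have d2 : deriv (fun x : ℝ => x ^ 3) = fun x => 3 * x ^ 2 := by
    funext x
    simp
  -- The two monomials satisfy the clamped conditions, and their pairs `(φ(L), φ'(L))` are linearly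
  -- independent, so both boundary coefficients vanish.
  have p1 := bc (fun x => x ^ 2) (by fun_prop) (by simp) (by simp)
  have p2 := bc (fun x => x ^ 3) (by fun_prop) (by simp) (by simp)
  rw [d1] at p1
  rw [d2] at p2
  have hL2 : L ^ 2 ≠ 0 := pow_ne_zero 2 hL.ne'
  have r1 : M L = 0 := by
    have : L ^ 2 * M L = 0 := by linear_combination p2 - L * p1
    exact (mul_eq_zero.1 this).resolve_left hL2
  have r2 : Q L - M₁ L = 0 := by
    have : L ^ 2 * (Q L - M₁ L) = 0 := by linear_combination p1 - 2 * L * r1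
    exact (mul_eq_zero.1 this).resolve_left hL2
  refine ⟨hFN.congr hF (ae_eq_refl _), ?_, ?_⟩
  · rw [t1, t2, s2]
    linear_combination r1
  · rw [t1, t2, t3, s3]
    linear_combination -r2

/-! ### Evolution in time -/

variable {T : ℝ}

/-- A function with values in a Banach space `H` that has a weak time derivative with values in
`H`, where the duality is tested in a larger space `E` only, is a.e. equal to a primitive. -/
theorem exists_ae_eq_add_integral {H E : Type*} [NormedAddCommGroup H] [NormedSpace ℝ H]
    [CompleteSpace H] [NormedAddCommGroup E] [NormedSpace ℝ E] [CompleteSpace E] (hT : 0 < T)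
    (i : H →L[ℝ] E) (hi : Function.Injective i) {f g : ℝ → H} (hf : IntegrableOn f (Ioo 0 T))
    (hg : IntegrableOn g (Ioo 0 T))
    (h : ∀ η, IsTest T η → ∫ t in Ioo 0 T, deriv η t • i (f t) = -∫ t in Ioo 0 T, η t • i (g t)) :
    ∃ c : H, f =ᵐ[volume.restrict (Ioo 0 T)] fun t => c + ∫ s in (0 : ℝ)..t, g s := by
  have hG : IntegrableOn (fun t => ∫ s in (0 : ℝ)..t, g s) (Ioo 0 T) :=
    (continuousOn_integral hT.le hg).integrableOn_Icc.mono_set Ioo_subset_Icc_self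
  obtain ⟨c, hc⟩ := ae_const_of_integral_deriv_smul_eq_zero hT (hf.sub hG) fun η hη => by
    -- The identity in `E` lifts to `H` because `i` is injective and commutes with Bochner
    -- integrals.
    have h1 : ∫ t in Ioo 0 T, deriv η t • f t = -∫ t in Ioo 0 T, η t • g t := by
      apply hi
      rw [map_neg, ← i.integral_comp_comm (hη.derivative.integrable_smul hf),
        ← i.integral_comp_comm (hη.integrable_smul hg)]
      simpa only [map_smul] using h η hη
    simp only [Pi.sub_apply, smul_sub]
    rw [integral_sub (hη.derivative.integrable_smul hf) (hη.derivative.integrable_smul hG), h1,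
      integral_deriv_smul_integral hT.le hg hη hG, sub_self]
  refine ⟨c, ?_⟩
  filter_upwards [hc] with t ht
  rw [← ht, Pi.sub_apply, sub_add_cancel]

/-- A set of full measure is dense, and a closed condition extends from a dense set of times by
continuity. -/
theorem mem_of_ae_mem {H : Type*} [TopologicalSpace H] (hT : 0 < T) {X : Set H} (hX : IsClosed X)
    {v : ℝ → H} (hv : ContinuousOn v (Icc 0 T))
    (h : ∀ᵐ t ∂(volume.restrict (Ioo 0 T)), v t ∈ X) {t : ℝ} (ht : t ∈ Icc 0 T) : v t ∈ X := by
  rw [ae_restrict_iff' measurableSet_Ioo] at h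
  have hd : Dense {t | t ∈ Ioo 0 T → v t ∈ X} := Measure.dense_of_ae h
  have hcl : t ∈ closure (Ioo 0 T ∩ {t | t ∈ Ioo 0 T → v t ∈ X}) := by
    have := closure_mono (hd.open_subset_closure_inter (t := Ioo 0 T) isOpen_Ioo)
    rw [closure_Ioo hT.ne, closure_closure] at this
    exact this ht
  have hw : ContinuousWithinAt v (Ioo 0 T ∩ {t | t ∈ Ioo 0 T → v t ∈ X}) t :=
    (hv t ht).mono (inter_subset_left.trans Ioo_subset_Icc_self)
  refine hX.closure_subset_iff.2 ?_ (hw.mem_closure_image hcl)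
  rintro _ ⟨s, hs, rfl⟩
  exact hs.2 hs.1

/-- Every right neighbourhood of `a` has positive measure. This makes essential limits unique, as
the initial conditions need. -/
instance neBot_nhdsGT_inf_ae (a : ℝ) : (𝓝[>] a ⊓ ae (volume : Measure ℝ)).NeBot := by
  rw [inf_neBot_iff]
  intro s hs t ht
  obtain ⟨b, hb, hbs⟩ := mem_nhdsGT_iff_exists_Ioo_subset.1 hs
  by_contra hcon
  have hsub : Ioo a b ⊆ tᶜ := fun x hx hxt => hcon ⟨x, hbs hx, hxt⟩
  have h0 := measure_mono_null hsub ht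
  rw [Real.volume_Ioo, ENNReal.ofReal_eq_zero] at h0
  exact absurd (mem_Ioi.1 hb) (by linarith)

theorem eventuallyEq_nhdsGT_inf_ae {H : Type*} (hT : 0 < T) {f g : ℝ → H}
    (h : f =ᵐ[volume.restrict (Ioo 0 T)] g) :
    f =ᶠ[𝓝[>] 0 ⊓ ae (volume : Measure ℝ)] g := by
  rw [EventuallyEq, ae_restrict_iff' measurableSet_Ioo] at h
  filter_upwards [h.filter_mono inf_le_right,
    mem_inf_of_left (Ioo_mem_nhdsGT hT)] with t h1 h2 using h1 h2

theorem tendsto_nhdsGT_inf_ae {H : Type*} [TopologicalSpace H] (hT : 0 < T) {v : ℝ → H}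
    (hv : ContinuousOn v (Icc 0 T)) :
    Tendsto v (𝓝[>] 0 ⊓ ae (volume : Measure ℝ)) (𝓝 (v 0)) := by
  have h := (hv 0 (left_mem_Icc.2 hT.le)).mono Ioo_subset_Icc_self
  rw [ContinuousWithinAt, nhdsWithin_Ioo_eq_nhdsGT hT] at h
  exact h.mono_left inf_le_left

/-- Uniqueness for the linear equation `y' = a y` in integrated form. -/
theorem eq_zero_of_integral_eq (hT : 0 < T) {y z a : ℝ → ℝ} (hy : ContinuousOn y (Icc 0 T))
    (ha : ContinuousOn a (Icc 0 T)) (hyz : ∀ t ∈ Icc 0 T, y t = ∫ s in (0 : ℝ)..t, z s)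
    (hz : ∀ᵐ t ∂(volume.restrict (Ioo 0 T)), z t = a t * y t) : ∀ t ∈ Icc 0 T, y t = 0 := by
  obtain ⟨K, hK⟩ := isCompact_Icc.exists_bound_of_continuousOn ha
  have hay : ContinuousOn (fun t => a t * y t) (Icc 0 T) := ha.mul hy
  -- The continuous extension to the whole line has a primitive differentiable everywhere, which
  -- allows the classical Grönwall inequality although `z` is only known a.e.
  set F : ℝ → ℝ := IccExtend hT.le ((Icc 0 T).domRestrict fun t => a t * y t) with hF
  have hFc : Continuous F := hay.domRestrict.Icc_extend'
  have hFe : ∀ t ∈ Icc 0 T, F t = a t * y t := fun t ht => IccExtend_of_mem _ _ ht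
  have hd : ∀ t, HasDerivAt (fun t => ∫ s in (0 : ℝ)..t, F s) (F t) t := fun t =>
    intervalIntegral.integral_hasDerivAt_right (hFc.intervalIntegrable _ _)
      hFc.stronglyMeasurable.stronglyMeasurableAtFilter hFc.continuousAt
  have hyF : ∀ t ∈ Icc 0 T, y t = ∫ s in (0 : ℝ)..t, F s := by
    intro t ht
    rw [hyz t ht, intervalIntegral.integral_of_le ht.1, intervalIntegral.integral_of_le ht.1,
      integral_Ioc_eq_integral_Ioo, integral_Ioc_eq_integral_Ioo]
    refine integral_congr_ae ?_
    filter_upwards [ae_restrict_of_ae_restrict_of_subset (Ioo_subset_Ioo_right ht.2) hz,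
      ae_restrict_mem measurableSet_Ioo] with s h1 h2
    rw [h1, hFe s ⟨h2.1.le, h2.2.le.trans ht.2⟩]
  intro t ht
  have hg := norm_le_gronwallBound_of_norm_deriv_right_le (δ := 0) (K := K) (ε := 0)
    (f := fun t => ∫ s in (0 : ℝ)..t, F s) (f' := F) (a := 0) (b := T)
    (fun s _ => (hd s).continuousAt.continuousWithinAt) (fun s _ => (hd s).hasDerivWithinAt)
    (by simp) (fun s hs => by
      have hs' : s ∈ Icc 0 T := ⟨hs.1, hs.2.le⟩
      rw [hFe s hs', ← hyF s hs', norm_mul, add_zero]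
      exact mul_le_mul_of_nonneg_right (hK s hs') (norm_nonneg _)) t ht
  rw [gronwallBound_ε0, zero_mul, ← hyF t ht] at hg
  exact norm_le_zero_iff.1 hg

/-- The embedding of `H⁴(0,L)` into `H²(0,L)`. -/
def trunc (v : Sobolev L 4) : Sobolev L 2 :=
  ⟨WithLp.toLp 2 fun j => dx v (Fin.castLE (by norm_num) j), fun j => v.2 (Fin.castLE _ j)⟩

theorem trunc_mem_clamped {v : Sobolev L 4} (hv : v ∈ Clamped L 4) : trunc v ∈ Clamped L 2 := hv

theorem sub_mem_clamped (hL : 0 < L) {v w : Sobolev L 2} (hv : v ∈ Clamped L 2)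
    (hw : w ∈ Clamped L 2) : v - w ∈ Clamped L 2 := by
  have h1 := (mem_clamped_iff (k := 0) hL v).1 hv
  have h2 := (mem_clamped_iff (k := 0) hL w).1 hw
  refine (mem_clamped_iff (k := 0) hL _).2 ⟨?_, ?_⟩
  · rw [map_sub, h1.1, h2.1, sub_zero]
  · rw [map_sub, h1.2, h2.2, sub_zero]

/-- The exceptional null set depends on `φ`. A countable dense family has a common one, and
closedness in `φ` extends the identity to the rest. -/
theorem ae_forall_weakForm (hL : 0 < L) {D k₂ : ℝ} {p : ℝ → L2 L} {w wt : ℝ → Sobolev L 4}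
    {wtt : ℝ → Sobolev L 2}
    (h : ∀ φ ∈ Clamped L 2, ∀ᵐ t ∂(volume.restrict (Ioo 0 T)),
      WeakForm D k₂ (p t) (w t) (wt t) (wtt t) φ) :
    ∀ᵐ t ∂(volume.restrict (Ioo 0 T)), ∀ φ ∈ Clamped L 2,
      WeakForm D k₂ (p t) (w t) (wt t) (wtt t) φ := by
  obtain ⟨s, hs, hd⟩ := TopologicalSpace.exists_countable_dense (Clamped L 2)
  have := (ae_ball_iff hs).2 fun φ (_ : φ ∈ s) => h φ φ.2
  filter_upwards [this] with t ht φ hφ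
  have hc : IsClosed {ψ : Clamped L 2 | WeakForm D k₂ (p t) (w t) (wt t) (wtt t) ψ} :=
    (isClosed_weakForm hL D k₂ (p t) (w t) (wt t) (wtt t)).preimage continuous_subtype_val
  have hsub : closure s ⊆ {ψ : Clamped L 2 | WeakForm D k₂ (p t) (w t) (wt t) (wtt t) ψ} :=
    hc.closure_subset_iff.2 ht
  exact hsub (hd ⟨φ, hφ⟩)

/-- `S` may be nonlinear: square integrability comes from boundedness along the continuous
representative on the compact interval. -/
theorem memLp_comp_of_continuous {H E : Type*} [TopologicalSpace H] [NormedAddCommGroup E]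
    [SecondCountableTopologyEither ℝ E]
    {S : H → E} (hS : Continuous S) {v w : ℝ → H} (hv : ContinuousOn v (Icc 0 T))
    (hvw : w =ᵐ[volume.restrict (Ioo 0 T)] v) :
    MemLp (fun t => S (w t)) 2 (volume.restrict (Ioo 0 T)) := by
  have hc := hS.comp_continuousOn hv
  obtain ⟨C, hC⟩ := isCompact_Icc.exists_bound_of_continuousOn hc
  have : MemLp (fun t => S (v t)) 2 (volume.restrict (Ioo 0 T)) :=
    MemLp.of_bound ((hc.mono Ioo_subset_Icc_self).aestronglyMeasurable measurableSet_Ioo) C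
      (ae_restrict_of_forall_mem measurableSet_Ioo fun x hx => hC x (Ioo_subset_Icc_self hx))
  exact (memLp_congr_ae (hvw.fun_comp S)).2 this

/-! ### Regularity in time, initial data, the equation and the free end. -/

namespace IsSolutionIn
variable {X : Set (Sobolev L 4)} {D k₂ : ℝ} {p : ℝ → L2 L} {w₀ : Sobolev L 2} {w₁ : L2 L}
  {w wt : ℝ → Sobolev L 4} {wtt : ℝ → Sobolev L 2}

theorem mono {Y : Set (Sobolev L 4)} (hXY : X ⊆ Y) (h : IsSolutionIn X D k₂ T p w₀ w₁ w wt wtt) :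
    IsSolutionIn Y D k₂ T p w₀ w₁ w wt wtt :=
  { h with
    w_mem := h.w_mem.mono fun _ ht => hXY ht
    wt_mem := h.wt_mem.mono fun _ ht => hXY ht }

theorem integrableOn_wt (h : IsSolutionIn X D k₂ T p w₀ w₁ w wt wtt) :
    IntegrableOn wt (Ioo 0 T) :=
  h.memLp_wt.integrable (by norm_num)

theorem exists_ae_eq (hT : 0 < T) (h : IsSolutionIn X D k₂ T p w₀ w₁ w wt wtt) :
    ∃ c : Sobolev L 4, w =ᵐ[volume.restrict (Ioo 0 T)] fun t => c + ∫ s in (0 : ℝ)..t, wt s :=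
  exists_ae_eq_add_integral hT (dxL L 4 0) dx_zero_injective
    (h.memLp_w.integrable (by norm_num)) h.integrableOn_wt h.timeDeriv_w

theorem continuousOn_rep (hT : 0 < T) (h : IsSolutionIn X D k₂ T p w₀ w₁ w wt wtt)
    (c : Sobolev L 4) : ContinuousOn (fun t => c + ∫ s in (0 : ℝ)..t, wt s) (Icc 0 T) :=
  continuousOn_const.add (continuousOn_integral hT.le h.integrableOn_wt)

theorem rep_mem (hT : 0 < T) (hX : IsClosed X) (h : IsSolutionIn X D k₂ T p w₀ w₁ w wt wtt)
    {c : Sobolev L 4} (hc : w =ᵐ[volume.restrict (Ioo 0 T)] fun t => c + ∫ s in (0 : ℝ)..t, wt s)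
    {t : ℝ} (ht : t ∈ Icc 0 T) : c + ∫ s in (0 : ℝ)..t, wt s ∈ X := by
  refine mem_of_ae_mem hT hX (h.continuousOn_rep hT c) ?_ ht
  filter_upwards [hc, h.w_mem] with s h1 h2
  rwa [← h1]

/-- The initial condition controls only `w_xx` weakly, but `χ = c - w₀` is itself an admissible test
function. It gives `‖χ_xx‖² = 0`, and then the clamped end forces `χ = 0`. -/
theorem initial_displacement (hL : 0 < L) (hT : 0 < T) (hD : D ≠ 0) (hw₀ : w₀ ∈ Clamped L 2)
    (h : IsSolutionIn (Clamped L 4) D k₂ T p w₀ w₁ w wt wtt) {c : Sobolev L 4}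
    (hc : w =ᵐ[volume.restrict (Ioo 0 T)] fun t => c + ∫ s in (0 : ℝ)..t, wt s) :
    dx c 0 = dx w₀ 0 := by
  have hcX : c ∈ Clamped L 4 := by
    have := h.rep_mem hT (isClosed_clamped (k := 2) hL) hc (left_mem_Icc.2 hT.le)
    rwa [intervalIntegral.integral_same, add_zero] at this
  have hχ := sub_mem_clamped hL (trunc_mem_clamped hcX) hw₀
  set χ := trunc c - w₀ with hχd
  have hχ2 : dx χ 2 = dx c 2 - dx w₀ 2 := rfl
  have l1 := h.init_w χ hχ
  have hcont : Continuous fun u : Sobolev L 4 => D * inner ℝ (dx u 2) (dx χ 2) := by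
    have : Continuous fun u : Sobolev L 4 => dx u 2 := (dxL L 4 2).continuous
    fun_prop
  have l2 := tendsto_nhdsGT_inf_ae hT (hcont.comp_continuousOn (h.continuousOn_rep hT c))
  have l3 := l2.congr' (f₂ := fun t => D * ip L (dx (w t) 2) (dx χ 2)) (by
    filter_upwards [eventuallyEq_nhdsGT_inf_ae hT hc] with t ht
    rw [ip_eq_inner, ht]
    rfl)
  have e := tendsto_nhds_unique l1 l3
  simp only [Function.comp_apply, intervalIntegral.integral_same, add_zero, ip_eq_inner] at e
  have e' := mul_left_cancel₀ hD e
  have h0 : dx χ 2 = 0 := by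
    rw [← inner_self_eq_zero (𝕜 := ℝ)]
    nth_rewrite 1 [hχ2]
    rw [inner_sub_left, e', sub_self]
  have hz := clamped_eq_zero hL hχ h0
  have h00 : dx χ 0 = dx c 0 - dx w₀ 0 := rfl
  rw [hz] at h00
  exact (sub_eq_zero.1 h00.symm)

theorem initial_velocity (hT : 0 < T) (h : IsSolutionIn X D k₂ T p w₀ w₁ w wt wtt) :
    ∃ v' : ℝ → L2 L, ContinuousOn v' (Icc 0 T) ∧
      v' =ᵐ[volume.restrict (Ioo 0 T)] (fun t => dx (wt t) 0) ∧ v' 0 = w₁ := by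
  have i1 : IntegrableOn (fun t => dx (wt t) 0) (Ioo 0 T) :=
    (dxL L 4 0).integrable_comp h.integrableOn_wt
  have i2 : IntegrableOn (fun t => dx (wtt t) 0) (Ioo 0 T) :=
    (dxL L 2 0).integrable_comp (h.memLp_wtt.integrable (by norm_num))
  obtain ⟨c, hc⟩ := exists_ae_eq_add_integral hT (ContinuousLinearMap.id ℝ (L2 L))
    Function.injective_id i1 i2 h.timeDeriv_wt
  have hv : ContinuousOn (fun t => c + ∫ s in (0 : ℝ)..t, dx (wtt s) 0) (Icc 0 T) :=
    continuousOn_const.add (continuousOn_integral hT.le i2)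
  refine ⟨_, hv, hc.symm, ?_⟩
  simp only [intervalIntegral.integral_same, add_zero]
  refine ext_inner_right ℝ fun ψ => ?_
  have hcont : Continuous fun u : L2 L => inner ℝ u ψ := by fun_prop
  have l2 := tendsto_nhdsGT_inf_ae hT (hcont.comp_continuousOn hv)
  have l3 := l2.congr' (f₂ := fun t => ip L (dx (wt t) 0) ψ) (by
    filter_upwards [eventuallyEq_nhdsGT_inf_ae hT hc] with t ht
    rw [ip_eq_inner, ht]
    rfl)
  have e := tendsto_nhds_unique l3 (h.init_wt ψ)
  simpa only [Function.comp_apply, intervalIntegral.integral_same, add_zero, ip_eq_inner] using e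

theorem solvesPDE (hL : 0 < L) (hT : 0 < T) (hp : MemLp p 2 (volume.restrict (Ioo 0 T)))
    (h : IsSolutionIn X D k₂ T p w₀ w₁ w wt wtt) : SolvesPDE D k₂ T p w wt wtt := by
  obtain ⟨S₁, hS₁c, hS₁⟩ := exists_cubic₁ hL
  obtain ⟨S₂, hS₂c, hS₂⟩ := exists_cubic₂ hL
  obtain ⟨c, hc⟩ := h.exists_ae_eq hT
  have m1 := memLp_comp_of_continuous hS₁c (h.continuousOn_rep hT c) hc
  have m2 := memLp_comp_of_continuous hS₂c (h.continuousOn_rep hT c) hc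
  have m3 : MemLp (fun t => dx (wtt t) 0) 2 (volume.restrict (Ioo 0 T)) :=
    (dxL L 2 0).comp_memLp' h.memLp_wtt
  have m4 : MemLp (fun t => dx (w t) 4) 2 (volume.restrict (Ioo 0 T)) :=
    (dxL L 4 4).comp_memLp' h.memLp_w
  have m5 : MemLp (fun t => dx (wt t) 4) 2 (volume.restrict (Ioo 0 T)) :=
    (dxL L 4 4).comp_memLp' h.memLp_wt
  refine ⟨fun t => S₁ (w t), fun t => S₂ (w t),
    -- The derivative of the flux is defined as the residual of the equation, so it is in `L²` in
    -- time; `stationary` shows that it is the weak derivative.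
    fun t => p t - dx (wtt t) 0 - D • dx (w t) 4 - k₂ • dx (wt t) 4 + D • S₁ (w t) - D • S₂ (w t),
    m1, m2, ((((hp.sub m3).sub (m4.const_smul D)).sub (m5.const_smul k₂)).add
      (m1.const_smul D)).sub (m2.const_smul D), ?_⟩
  filter_upwards [ae_forall_weakForm hL h.weakForm] with t ht
  refine ⟨isWeakDeriv_cubic₁ hL (w t) (hS₁ (w t)), isWeakDeriv_cubic₂ hL (w t) (hS₂ (w t)),
    (stationary hL (hS₁ (w t)) (hS₂ (w t)) rfl ht).1, ?_⟩
  abel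

theorem boundary_relations (hL : 0 < L) (h : IsSolutionIn X D k₂ T p w₀ w₁ w wt wtt) :
    ∀ᵐ t ∂(volume.restrict (Ioo 0 T)),
      k₂ * endTrace L 4 2 L (wt t)
        = -(D * (1 + endTrace L 4 1 L (w t) ^ 2)) * endTrace L 4 2 L (w t) ∧
      k₂ * endTrace L 4 3 L (wt t)
        = -(D * (1 + endTrace L 4 1 L (w t) ^ 2)) * endTrace L 4 3 L (w t)
          - D * endTrace L 4 2 L (w t) ^ 2 * endTrace L 4 1 L (w t) := by
  obtain ⟨S₁, -, hS₁⟩ := exists_cubic₁ hL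
  obtain ⟨S₂, -, hS₂⟩ := exists_cubic₂ hL
  filter_upwards [ae_forall_weakForm hL h.weakForm] with t ht
  exact (stationary hL (hS₁ (w t)) (hS₂ (w t)) rfl ht).2

/-- The free-end conditions are preserved by the evolution. -/
theorem freeEnd_rep (hL : 0 < L) (hT : 0 < T) (hk₂ : k₂ ≠ 0)
    (h : IsSolutionIn X D k₂ T p w₀ w₁ w wt wtt) {c : Sobolev L 4}
    (hc : w =ᵐ[volume.restrict (Ioo 0 T)] fun t => c + ∫ s in (0 : ℝ)..t, wt s)
    (hc0 : FreeEnd L c) : ∀ t ∈ Icc 0 T, FreeEnd L (c + ∫ s in (0 : ℝ)..t, wt s) := by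
  obtain ⟨c2, c3⟩ := (freeEnd_iff hL c).1 hc0
  set v : ℝ → Sobolev L 4 := fun t => c + ∫ s in (0 : ℝ)..t, wt s with hv
  have hvc : ContinuousOn v (Icc 0 T) := h.continuousOn_rep hT c
  have htr : ∀ j, ContinuousOn (fun t => endTrace L 4 j L (v t)) (Icc 0 T) := fun j =>
    (endTrace L 4 j L).continuous.comp_continuousOn hvc
  have hint : ∀ j, endTrace L 4 j L c = 0 → ∀ t ∈ Icc 0 T,
      endTrace L 4 j L (v t) = ∫ s in (0 : ℝ)..t, endTrace L 4 j L (wt s) := by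
    intro j hj t ht
    have hi : IntervalIntegrable wt volume 0 t := by
      rw [intervalIntegrable_iff_integrableOn_Ioo_of_le ht.1]
      exact h.integrableOn_wt.mono_set (Ioo_subset_Ioo_right ht.2)
    rw [hv, map_add, hj, zero_add, (endTrace L 4 j L).intervalIntegral_comp_comm hi]
  have ha : ContinuousOn (fun t => -(D * (1 + endTrace L 4 1 L (v t) ^ 2)) / k₂) (Icc 0 T) :=
    ((continuousOn_const.mul (continuousOn_const.add ((htr 1).pow 2))).neg).div_const _
  -- Along the given solution `w_x(L,t)` is a known continuous function, so the relation for
  -- `w_xx(L,t)` is linear and homogeneous.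
  have y2 := eq_zero_of_integral_eq hT (htr 2) ha (hint 2 c2) (by
    filter_upwards [h.boundary_relations hL, hc] with t h1 h2
    rw [← h2, div_mul_eq_mul_div, eq_div_iff hk₂, ← h1.1, mul_comm])
  -- With `w_xx(L,t) = 0` the inhomogeneous term `D w_xx² w_x` drops out, leaving the same linear
  -- equation for `w_xxx(L,t)`.
  have y3 := eq_zero_of_integral_eq hT (htr 3) ha (hint 3 c3) (by
    filter_upwards [h.boundary_relations hL, hc, ae_restrict_mem measurableSet_Ioo] with t h1 h2 h3
    have h4 := y2 t (Ioo_subset_Icc_self h3)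
    have h5 := h1.2
    rw [h2, h4] at h5
    rw [div_mul_eq_mul_div, eq_div_iff hk₂, mul_comm, h5]
    ring)
  exact fun t ht => (freeEnd_iff hL _).2 ⟨y2 t ht, y3 t ht⟩

theorem satisfiesBoundaryAndInitial (hL : 0 < L) (hT : 0 < T) (hD : D ≠ 0)
    (hw₀ : w₀ ∈ Clamped L 2) (h : IsSolutionIn (Clamped L 4) D k₂ T p w₀ w₁ w wt wtt)
    {c : Sobolev L 4}
    (hc : w =ᵐ[volume.restrict (Ioo 0 T)] fun t => c + ∫ s in (0 : ℝ)..t, wt s)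
    (hfree : ∀ t ∈ Icc 0 T, FreeEnd L (c + ∫ s in (0 : ℝ)..t, wt s)) :
    SatisfiesBoundaryAndInitial T w₀ w₁ w wt := by
  refine ⟨⟨_, h.continuousOn_rep hT c, hc.symm, fun t ht =>
    ⟨h.rep_mem hT (isClosed_clamped (k := 2) hL) hc ht, hfree t ht⟩, ?_⟩, h.initial_velocity hT⟩
  simp only [intervalIntegral.integral_same, add_zero]
  exact h.initial_displacement hL hT hD hw₀ hc

end IsSolutionIn

end Cantilever

end

theorem corollary5p2 {L T D k₂ : ℝ} (hL : 0 < L) (hT : 0 < T) (hD : 0 < D) (hk₂ : 0 < k₂)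
    (p : ℝ → Cantilever.L2 L) (hp : MemLp p 2 (volume.restrict (Ioo 0 T)))
    (w₀ : Cantilever.Sobolev L 2) (hw₀ : w₀ ∈ Cantilever.Clamped L 2) (w₁ : Cantilever.L2 L)
    (w wt : ℝ → Cantilever.Sobolev L 4) (wtt : ℝ → Cantilever.Sobolev L 2) :
    -- strong solutions
    (Cantilever.IsStrongSolution D k₂ T p w₀ w₁ w wt wtt →
      Cantilever.SolvesPDE D k₂ T p w wt wtt ∧
      Cantilever.SatisfiesBoundaryAndInitial T w₀ w₁ w wt) ∧
    -- the free-end conditions are natural: they need only be imposed on the initial displacement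
    ((∃ v ∈ Cantilever.DomA L, Cantilever.dx v 0 = Cantilever.dx w₀ 0) →
      Cantilever.IsSolutionIn (Cantilever.Clamped L 4) D k₂ T p w₀ w₁ w wt wtt →
      Cantilever.SolvesPDE D k₂ T p w wt wtt ∧
      Cantilever.SatisfiesBoundaryAndInitial T w₀ w₁ w wt) := by
  constructor
  · intro h
    have hcl : Cantilever.IsSolutionIn (Cantilever.Clamped L 4) D k₂ T p w₀ w₁ w wt wtt :=
      Cantilever.IsSolutionIn.mono (fun _ hv => hv.1) h
    obtain ⟨c, hc⟩ := hcl.exists_ae_eq hT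
    exact ⟨hcl.solvesPDE hL hT hp, hcl.satisfiesBoundaryAndInitial hL hT hD.ne' hw₀ hc fun t ht =>
      (Cantilever.IsSolutionIn.rep_mem hT (Cantilever.isClosed_domA hL) h hc ht).2⟩
  · rintro ⟨u, hu, hu0⟩ h
    obtain ⟨c, hc⟩ := h.exists_ae_eq hT
    -- The value at time zero, a priori only clamped, is the given element of `DomA`; this supplies
    -- the zero initial traces.
    have hcu : c = u := Cantilever.dx_zero_injective
      ((h.initial_displacement hL hT hD.ne' hw₀ hc).trans hu0.symm)
    exact ⟨h.solvesPDE hL hT hp, h.satisfiesBoundaryAndInitial hL hT hD.ne' hw₀ hc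
      (h.freeEnd_rep hL hT hk₂.ne' hc (hcu ▸ hu.2))⟩
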